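/- Let $b_1,b_2>0$. For $k=(k_1,k_2)$ with $k_1,k_2>0$ let $S_k\subset\mathbb R^5$ be the level surface of the Suslov problem with the Klebsh–Tisserand potential, i.e. the set of all $(m_1,m_2,\gamma_1,\gamma_2,\gamma_3)\in\mathbb R^5$ with $$m_1^2+b_1\gamma_1^2=k_1,\qquad m_2^2+b_2\gamma_2^2=k_2,\qquad \gamma_1^2+\gamma_2^2+\gamma_3^2=1 .$$ The lines $k_1=b_1$, $k_2=b_2$ and $\frac{k_1}{b_1}+\frac{k_2}{b_2}=1$ divide the open first quadrant $\{k_1>0,\ k_2>0\}$ into the five open regions $$D_1=\{\tfrac{k_1}{b_1}+\tfrac{k_2}{b_2}<1\},\qquad D_2=\{k_1<b_1,\ k_2<b_2,\ \tfrac{k_1}{b_1}+\tfrac{k_2}{b_2}>1\},$$ $$D_3=\{k_1>b_1,\ k_2<b_2\},\qquad D_4=\{k_1<b_1,\ k_2>b_2\},\qquad D_5=\{k_1>b_1,\ k_2>b_2\}.$$ In each of these regions $S_k$ is a smoothly embedded compact surface in $\mathbb R^5$, of the following type. - For $k\in D_1$, $S_k$ is diffeomorphic to the disjoint union of two copies of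 the torus $T^2=S^1\times S^1$. - For $k\in D_2$, $S_k$ is a closed connected orientable surface of genus $5$ (equivalently, closed, connected and orientable with Euler characteristic $2-2\cdot 5=-8$). - For $k\in D_3$ or $k\in D_4$, $S_k$ is diffeomorphic to the disjoint union of two copies of $T^2$. - For $k\in D_5$, $S_k$ is diffeomorphic to the disjoint union of four copies of the sphere $S^2$. -/

import Mathlib

open scoped Manifold ContDiff

/-! ### The level surfaces -/

/-- The level surface `S_k` of the Suslov problem with the Klebsh–Tisserand potential, as a subset
of `ℝ⁵` with coordinates `(m₁, m₂, γ₁, γ₂, γ₃) = (x 0, x 1, x 2, x 3, x 4)`. -/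
def suslovSurface (b₁ b₂ k₁ k₂ : ℝ) : Set (EuclideanSpace ℝ (Fin 5)) :=
  {x | x 0 ^ 2 + b₁ * x 2 ^ 2 = k₁ ∧
       x 1 ^ 2 + b₂ * x 3 ^ 2 = k₂ ∧
       x 2 ^ 2 + x 3 ^ 2 + x 4 ^ 2 = 1}

/-! ### The five open regions of the first quadrant cut out by the lines
`k₁ = b₁`, `k₂ = b₂` and `k₁ / b₁ + k₂ / b₂ = 1` -/

def regionD1 (b₁ b₂ : ℝ) : Set (ℝ × ℝ) :=
  {k | 0 < k.1 ∧ 0 < k.2 ∧ k.1 / b₁ + k.2 / b₂ < 1}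

def regionD2 (b₁ b₂ : ℝ) : Set (ℝ × ℝ) :=
  {k | 0 < k.1 ∧ 0 < k.2 ∧ k.1 < b₁ ∧ k.2 < b₂ ∧ 1 < k.1 / b₁ + k.2 / b₂}

def regionD3 (b₁ b₂ : ℝ) : Set (ℝ × ℝ) :=
  {k | 0 < k.1 ∧ 0 < k.2 ∧ b₁ < k.1 ∧ k.2 < b₂}

def regionD4 (b₁ b₂ : ℝ) : Set (ℝ × ℝ) :=
  {k | 0 < k.1 ∧ 0 < k.2 ∧ k.1 < b₁ ∧ b₂ < k.2}

def regionD5 (b₁ b₂ : ℝ) : Set (ℝ × ℝ) :=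
  {k | 0 < k.1 ∧ 0 < k.2 ∧ b₁ < k.1 ∧ b₂ < k.2}

/-! ### Diffeomorphism of a subset of Euclidean space with a manifold -/

/-- `S` is an embedded `C^∞` submanifold of `ℝⁿ` diffeomorphic to the manifold `M`: there is a
smooth embedding (a smooth map with injective differentials that is a homeomorphism onto its
image) of `M` into `ℝⁿ` with image `S`. -/
def IsDiffeomorphicCopy {E H : Type*} [NormedAddCommGroup E] [NormedSpace ℝ E]
    [TopologicalSpace H] (I : ModelWithCorners ℝ E H) (M : Type*) [TopologicalSpace M]
    [ChartedSpace H M] {n : ℕ} (S : Set (EuclideanSpace ℝ (Fin n))) : Prop :=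
  ∃ f : M → EuclideanSpace ℝ (Fin n),
    ContMDiff I (𝓡 n) ∞ f ∧
    (∀ p : M, Function.Injective (mfderiv I (𝓡 n) f p)) ∧
    Topology.IsEmbedding f ∧
    Set.range f = S

/-- The torus `T² = S¹ × S¹`, a manifold modelled on `(𝓡 1).prod (𝓡 1)`. -/
abbrev Torus2 : Type := Circle × Circle

/-- The unit sphere `S²` in `ℝ³`, a manifold modelled on `𝓡 2`. -/
abbrev Sphere2 : Type := Metric.sphere (0 : EuclideanSpace ℝ (Fin 3)) 1

/-! ### Closed orientable surfaces and their genus -/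

/-- `x, y, z` are the three distinct vertices of a triangle (2-simplex) of `K`. -/
def IsTriangle {E : Type*} [AddCommGroup E] [Module ℝ E] (K : Geometry.SimplicialComplex ℝ E)
    (x y z : E) : Prop :=
  x ≠ y ∧ y ≠ z ∧ x ≠ z ∧ ∃ t ∈ K.faces, (t : Set E) = {x, y, z}

/-- The triangles of `K` can be coherently oriented. An orientation of a triangle is a sign
`ε x y z` for each ordering of its vertices that changes under transpositions; two different
triangles with a common edge `{x, y}` have to induce opposite orientations on it. -/
def IsCoherentlyOrientable {E : Type*} [AddCommGroup E] [Module ℝ E]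
    (K : Geometry.SimplicialComplex ℝ E) : Prop :=
  ∃ ε : E → E → E → ℤˣ,
    (∀ x y z, IsTriangle K x y z → ε y x z = -ε x y z ∧ ε x z y = -ε x y z) ∧
    (∀ x y z w, IsTriangle K x y z → IsTriangle K x y w → z ≠ w → ε x y w = -ε x y z)

/-- The Euler characteristic of a finite simplicial complex: the alternating sum of the numbers
of simplices, a simplex with `j` vertices having dimension `j - 1`. -/
noncomputable def simplicialEulerChar {E : Type*} [AddCommGroup E] [Module ℝ E]
    (K : Geometry.SimplicialComplex ℝ E) (hK : K.faces.Finite) : ℤ :=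
  ∑ s ∈ hK.toFinset, (-1 : ℤ) ^ (s.card - 1)

/-- `X` is a closed connected orientable surface of genus `g`: a compact connected Hausdorff
topological 2-manifold (without boundary) with a finite triangulation that is coherently
orientable and has Euler characteristic `V - E + F = 2 - 2 g`. -/
def IsClosedOrientableSurfaceOfGenus (g : ℕ) (X : Type*) [TopologicalSpace X] : Prop :=
  CompactSpace X ∧ T2Space X ∧ ConnectedSpace X ∧
  Nonempty (ChartedSpace (EuclideanSpace ℝ (Fin 2)) X) ∧
  ∃ (N : ℕ) (K : Geometry.SimplicialComplex ℝ (EuclideanSpace ℝ (Fin N))) (hK : K.faces.Finite),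
    Nonempty (K.space ≃ₜ X) ∧
    IsCoherentlyOrientable K ∧
    simplicialEulerChar K hK = 2 - 2 * (g : ℤ)

/-- The subset `S` of `ℝⁿ` is an embedded `C^∞` closed connected orientable surface of
genus `g`. -/
def IsSmoothSurfaceOfGenus (g : ℕ) {n : ℕ} (S : Set (EuclideanSpace ℝ (Fin n))) : Prop :=
  ∃ (M : Type) (_ : TopologicalSpace M) (_ : ChartedSpace (EuclideanSpace ℝ (Fin 2)) M),
    IsManifold (𝓡 2) ∞ M ∧
    IsClosedOrientableSurfaceOfGenus g M ∧
    IsDiffeomorphicCopy (𝓡 2) M S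

/-! Rescaling m₁ and m₂ reduces everything to b₁ = b₂ = 1, with a = k₁/b₁ and b = k₂/b₂. Put s = γ₁²
and t = γ₂². The squares of the five coordinates are then a - s, b - t, s, t and 1 - s - t, so the
surface consists of 32 mirror images of the polygon on which these functions are nonnegative, glued
along its sides. A coordinate whose line misses the polygon never vanishes, and the surface splits
into two mirror halves.

Over D₁ this coordinate is γ₃, and the half γ₃ > 0 is a graph over a product of two circles. Over D₃
it is m₁, and the half m₁ > 0 is a graph over a torus in the remaining coordinates; D₄ follows by
symmetry. Over D₅ neither m₁ nor m₂ vanishes, and each of the four pieces is a graph over the sphere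
of γ. `IsDiffeomorphicCopy.of_leftInverse` certifies these parametrisations, and
`IsDiffeomorphicCopy.double` adds the mirror images.

Over D₂ all five lines carry sides, and 32 pentagons meet four at a vertex: 40 vertices, 80 edges
and 32 faces give -8. The smooth structure comes from the rank of the defining map
(`surjective_fderiv_suslovMap`, `exists_isManifold_levelSet`). For the topology, the homeomorphism x
↦ x|x| in every coordinate makes the surface polyhedral. Cutting each pentagon by two diagonals
gives `polyhedralComplex`; that it is a complex rests on the uniqueness of barycentric coordinates
(`weights_unique`), and that it covers the surface on their existence (`exists_weights`). Orienting
each mirror image by the product of its signs is coherent, because crossing a side flips exactly one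
sign. The surface is connected because paths through vertices can change every sign. -/

/-! ### Operations on embedded copies of manifolds -/

section DiffeomorphicCopies

variable {E H : Type*} [NormedAddCommGroup E] [NormedSpace ℝ E] [TopologicalSpace H]
  {I : ModelWithCorners ℝ E H} {M : Type*} [TopologicalSpace M] [ChartedSpace H M] {n : ℕ}

/-- The image of an embedded copy of `M` under a linear automorphism is an embedded copy. -/
theorem IsDiffeomorphicCopy.image {S : Set (EuclideanSpace ℝ (Fin n))}
    (h : IsDiffeomorphicCopy I M S)
    (L : EuclideanSpace ℝ (Fin n) ≃L[ℝ] EuclideanSpace ℝ (Fin n)) :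
    IsDiffeomorphicCopy I M (L '' S) := by
  obtain ⟨f, hf, hinj, hemb, rfl⟩ := h
  have hL : ContMDiff (𝓡 n) (𝓡 n) ∞ L := L.contDiff.contMDiff
  refine ⟨L ∘ f, hL.comp hf, fun p => ?_, L.toHomeomorph.isEmbedding.comp hemb,
    Set.range_comp _ _⟩
  rw [mfderiv_comp p (hL.mdifferentiable (by simp) _) (hf.mdifferentiable (by simp) _)]
  rw [mfderiv_eq_fderiv, L.fderiv]
  exact L.injective.comp (hinj p)

/-- The disjoint union of two embedded compact manifolds. -/
theorem IsDiffeomorphicCopy.sum {N : Type*} [TopologicalSpace N] [ChartedSpace H N]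
    [CompactSpace M] [CompactSpace N]
    {S T : Set (EuclideanSpace ℝ (Fin n))} (hS : IsDiffeomorphicCopy I M S)
    (hT : IsDiffeomorphicCopy I N T) (hST : Disjoint S T) :
    IsDiffeomorphicCopy I (M ⊕ N) (S ∪ T) := by
  obtain ⟨f, hf, hfi, hfe, rfl⟩ := hS
  obtain ⟨g, hg, hgi, hge, rfl⟩ := hT
  have hfg : ContMDiff I (𝓡 n) ∞ (Sum.elim f g) := hf.sumElim hg
  refine ⟨Sum.elim f g, hfg, ?_, ?_, Set.Sum.elim_range f g⟩
  · have hd := hfg.mdifferentiable (by simp)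
    rintro (p | p)
    · have h := hfi p
      have e : f = Sum.elim f g ∘ Sum.inl := rfl
      rw [e, mfderiv_comp p (hd _) hasMFDerivAt_inl.mdifferentiableAt, mfderiv_sumInl] at h
      · exact h
      · exact Sum.inl p
    · have h := hgi p
      have e : g = Sum.elim f g ∘ Sum.inr := rfl
      rw [e, mfderiv_comp p (hd _) hasMFDerivAt_inr.mdifferentiableAt, mfderiv_sumInr] at h
      exact h
  · refine (hfg.continuous.isClosedEmbedding ?_).isEmbedding
    refine hfe.injective.sumElim hge.injective fun a b hab => ?_
    exact Set.disjoint_left.1 hST ⟨a, rfl⟩ ⟨b, hab.symm⟩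

/-- If `ι` is an injective immersion of a compact manifold in a vector space and `Φ` is smooth at
the points of the image of `ι`, with a differentiable left inverse, then the image of `Φ ∘ ι` is
an embedded copy of the manifold. -/
theorem IsDiffeomorphicCopy.of_leftInverse [CompactSpace M] {V : Type*} [NormedAddCommGroup V]
    [NormedSpace ℝ V] {ι : M → V} (hι : ContMDiff I 𝓘(ℝ, V) ∞ ι)
    (hinj : Function.Injective ι)
    (himm : ∀ p, Function.Injective (mfderiv I 𝓘(ℝ, V) ι p))
    (Φ : V → EuclideanSpace ℝ (Fin n)) (Ψ : EuclideanSpace ℝ (Fin n) → V)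
    (hΦ : ∀ p, ContDiffAt ℝ ∞ Φ (ι p)) (hΨ : ∀ p, DifferentiableAt ℝ Ψ (Φ (ι p)))
    (hΨΦ : ∀ p, ∀ᶠ v in nhds (ι p), Ψ (Φ v) = v)
    {S : Set (EuclideanSpace ℝ (Fin n))} (hS : Set.range (Φ ∘ ι) = S) :
    IsDiffeomorphicCopy I M S := by
  have hsm : ContMDiff I (𝓡 n) ∞ (Φ ∘ ι) := fun p => (hΦ p).contMDiffAt.comp p (hι p)
  refine ⟨Φ ∘ ι, hsm, fun p => ?_, ?_, hS⟩
  · have hdΦ : DifferentiableAt ℝ Φ (ι p) := (hΦ p).differentiableAt (by simp)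
    rw [mfderiv_comp p hdΦ.mdifferentiableAt (hι.mdifferentiable (by simp) _), mfderiv_eq_fderiv]
    refine Function.Injective.comp (g := fderiv ℝ Φ (ι p)) ?_ (himm p)
    have h1 : fderiv ℝ (Ψ ∘ Φ) (ι p) = ContinuousLinearMap.id ℝ V := by
      have h2 : (Ψ ∘ Φ) =ᶠ[nhds (ι p)] id := hΨΦ p
      rw [h2.fderiv_eq, fderiv_id]
    rw [fderiv_comp _ (hΨ p) hdΦ] at h1
    exact Function.LeftInverse.injective (g := fderiv ℝ Ψ (Φ (ι p)))
      fun v => DFunLike.congr_fun h1 v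
  · refine (hsm.continuous.isClosedEmbedding ?_).isEmbedding
    intro p q h
    apply hinj
    rw [← (hΨΦ p).self_of_nhds, ← (hΨΦ q).self_of_nhds]
    exact congrArg Ψ h

end DiffeomorphicCopies

/-! ### The standard immersions of the torus and the sphere -/

theorem contMDiff_coe_circle : ContMDiff (𝓡 1) 𝓘(ℝ, ℂ) ∞ (fun z : Circle => (z : ℂ)) :=
  have := finrank_real_complex_fact'
  contMDiff_coe_sphere (E := ℂ) (n := 1)

theorem injective_mfderiv_coe_circle (z : Circle) :
    Function.Injective (mfderiv (𝓡 1) 𝓘(ℝ, ℂ) (fun z : Circle => (z : ℂ)) z) := by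
  have := finrank_real_complex_fact'
  have h := injective_mvfderiv_subtypeVal_sphere (E := ℂ) (n := 1) z
  exact h

theorem injective_mfderiv_coe_sphere2 (z : Sphere2) :
    Function.Injective (mfderiv (𝓡 2) 𝓘(ℝ, EuclideanSpace ℝ (Fin 3))
      ((↑) : Sphere2 → EuclideanSpace ℝ (Fin 3)) z) := by
  have : Fact (Module.finrank ℝ (EuclideanSpace ℝ (Fin 3)) = 2 + 1) := ⟨by simp⟩
  exact injective_mvfderiv_subtypeVal_sphere (n := 2) z

/-- The standard immersion of the torus in `ℂ²`. -/
def torusInclusion (p : Torus2) : ℂ × ℂ := (p.1, p.2)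

theorem contMDiff_torusInclusion :
    ContMDiff ((𝓡 1).prod (𝓡 1)) 𝓘(ℝ, ℂ × ℂ) ∞ torusInclusion :=
  (contMDiff_coe_circle.comp contMDiff_fst).prodMk_space (contMDiff_coe_circle.comp contMDiff_snd)

theorem injective_torusInclusion : Function.Injective torusInclusion := by
  rintro ⟨a, b⟩ ⟨c, d⟩ h
  simpa [torusInclusion, Prod.ext_iff, Circle.ext_iff] using h

theorem injective_mfderiv_torusInclusion (p : Torus2) :
    Function.Injective (mfderiv ((𝓡 1).prod (𝓡 1)) 𝓘(ℝ, ℂ × ℂ) torusInclusion p) := by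
  have hι := (contMDiff_torusInclusion.mdifferentiable (by simp)) p
  have hc := contMDiff_coe_circle.mdifferentiable (by simp)
  -- Composing with the linear projections of ℂ² recovers the differential of each circle factor,
  -- which is known to be injective.
  have h1 : ∀ v, mfderiv (𝓡 1) 𝓘(ℝ, ℂ) (fun z : Circle => (z : ℂ)) p.1 v.1 =
      (mfderiv ((𝓡 1).prod (𝓡 1)) 𝓘(ℝ, ℂ × ℂ) torusInclusion p v).1 := by
    intro v
    have e : (fun z : Circle => (z : ℂ)) ∘ (Prod.fst : Torus2 → Circle) =
      (ContinuousLinearMap.fst ℝ ℂ ℂ) ∘ torusInclusion := rfl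
    have e1 := mfderiv_comp (I := (𝓡 1).prod (𝓡 1)) (I'' := 𝓘(ℝ, ℂ)) p (hc p.1)
      (mdifferentiableAt_fst (I := 𝓡 1) (I' := 𝓡 1))
    have e2 := mfderiv_comp (I := (𝓡 1).prod (𝓡 1)) (I'' := 𝓘(ℝ, ℂ)) p
      ((ContinuousLinearMap.fst ℝ ℂ ℂ).mdifferentiableAt) hι
    rw [e, e2, mfderiv_fst, ContinuousLinearMap.mfderiv_eq] at e1
    exact (DFunLike.congr_fun e1 v).symm
  have h2 : ∀ v, mfderiv (𝓡 1) 𝓘(ℝ, ℂ) (fun z : Circle => (z : ℂ)) p.2 v.2 =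
      (mfderiv ((𝓡 1).prod (𝓡 1)) 𝓘(ℝ, ℂ × ℂ) torusInclusion p v).2 := by
    intro v
    have e : (fun z : Circle => (z : ℂ)) ∘ (Prod.snd : Torus2 → Circle) =
      (ContinuousLinearMap.snd ℝ ℂ ℂ) ∘ torusInclusion := rfl
    have e1 := mfderiv_comp (I := (𝓡 1).prod (𝓡 1)) (I'' := 𝓘(ℝ, ℂ)) p (hc p.2)
      (mdifferentiableAt_snd (I := 𝓡 1) (I' := 𝓡 1))
    have e2 := mfderiv_comp (I := (𝓡 1).prod (𝓡 1)) (I'' := 𝓘(ℝ, ℂ)) p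
      ((ContinuousLinearMap.snd ℝ ℂ ℂ).mdifferentiableAt) hι
    rw [e, e2, mfderiv_snd, ContinuousLinearMap.mfderiv_eq] at e1
    exact (DFunLike.congr_fun e1 v).symm
  intro v w hvw
  refine Prod.ext (injective_mfderiv_coe_circle p.1 ?_) (injective_mfderiv_coe_circle p.2 ?_)
  · rw [h1, h1, hvw]
  · rw [h2, h2, hvw]

/-! ### Normal form of the level surfaces -/

/-- The linear automorphism of `ℝⁿ` that multiplies the coordinates by given units. -/
noncomputable def diagonalEquiv {n : ℕ} (d : Fin n → ℝˣ) :
    EuclideanSpace ℝ (Fin n) ≃L[ℝ] EuclideanSpace ℝ (Fin n) :=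
  ((EuclideanSpace.equiv (Fin n) ℝ).trans
    (ContinuousLinearEquiv.piCongrRight fun i => ContinuousLinearEquiv.unitsEquivAut ℝ (d i))).trans
    (EuclideanSpace.equiv (Fin n) ℝ).symm

theorem diagonalEquiv_apply {n : ℕ} (d : Fin n → ℝˣ) (x : EuclideanSpace ℝ (Fin n)) (i : Fin n) :
    diagonalEquiv d x i = x i * d i := by
  simp [diagonalEquiv]

theorem image_eq_of_forall_mem_iff {n : ℕ}
    (L : EuclideanSpace ℝ (Fin n) ≃L[ℝ] EuclideanSpace ℝ (Fin n))
    {S T : Set (EuclideanSpace ℝ (Fin n))} (h : ∀ x, L x ∈ T ↔ x ∈ S) : L '' S = T := by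
  ext y
  constructor
  · rintro ⟨x, hx, rfl⟩
    exact (h x).2 hx
  · intro hy
    exact ⟨L.symm y, (h _).1 (by simpa using hy), by simp⟩

/-- Rescaling `m₁` and `m₂` brings a level surface to the case `b₁ = b₂ = 1`. -/
theorem exists_image_suslovSurface_eq {b₁ b₂ : ℝ} (hb₁ : 0 < b₁) (hb₂ : 0 < b₂) (k₁ k₂ : ℝ) :
    ∃ L : EuclideanSpace ℝ (Fin 5) ≃L[ℝ] EuclideanSpace ℝ (Fin 5),
      L '' suslovSurface 1 1 (k₁ / b₁) (k₂ / b₂) = suslovSurface b₁ b₂ k₁ k₂ := by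
  have h1 : √b₁ ≠ 0 := (Real.sqrt_pos.2 hb₁).ne'
  have h2 : √b₂ ≠ 0 := (Real.sqrt_pos.2 hb₂).ne'
  refine ⟨diagonalEquiv ![Units.mk0 _ h1, Units.mk0 _ h2, 1, 1, 1],
    image_eq_of_forall_mem_iff _ fun x => ?_⟩
  simp only [suslovSurface, Set.mem_ofPred_eq, diagonalEquiv_apply]
  simp only [Matrix.cons_val, Units.val_mk0, Units.val_one, mul_one, mul_pow, Real.sq_sqrt hb₁.le,
    Real.sq_sqrt hb₂.le, one_mul, eq_div_iff hb₁.ne', eq_div_iff hb₂.ne', add_mul, mul_comm b₁,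
    mul_comm b₂]

/-- The reflection of `ℝⁿ` in a coordinate. -/
noncomputable def coordReflection {n : ℕ} (i : Fin n) :
    EuclideanSpace ℝ (Fin n) ≃L[ℝ] EuclideanSpace ℝ (Fin n) :=
  diagonalEquiv (Function.update 1 i (-1))

theorem coordReflection_apply_self {n : ℕ} (i : Fin n) (x : EuclideanSpace ℝ (Fin n)) :
    coordReflection i x i = -x i := by
  simp [coordReflection, diagonalEquiv_apply]

theorem coordReflection_apply_of_ne {n : ℕ} {i j : Fin n} (h : j ≠ i)
    (x : EuclideanSpace ℝ (Fin n)) : coordReflection i x j = x j := by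
  simp [coordReflection, diagonalEquiv_apply, h]

theorem sq_coordReflection_apply {n : ℕ} (i j : Fin n) (x : EuclideanSpace ℝ (Fin n)) :
    coordReflection i x j ^ 2 = x j ^ 2 := by
  by_cases h : j = i
  · rw [h, coordReflection_apply_self, neg_sq]
  · rw [coordReflection_apply_of_ne h]

theorem coordReflection_mem_suslovSurface_iff {b₁ b₂ k₁ k₂ : ℝ} (i : Fin 5)
    (x : EuclideanSpace ℝ (Fin 5)) :
    coordReflection i x ∈ suslovSurface b₁ b₂ k₁ k₂ ↔ x ∈ suslovSurface b₁ b₂ k₁ k₂ := by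
  simp only [suslovSurface, Set.mem_ofPred_eq, sq_coordReflection_apply]

/-- A set that is invariant under the reflection in a coordinate and does not meet the mirror is
the disjoint union of two mirror images. -/
theorem IsDiffeomorphicCopy.double {E H : Type*} [NormedAddCommGroup E] [NormedSpace ℝ E]
    [TopologicalSpace H] {I : ModelWithCorners ℝ E H} {M : Type*} [TopologicalSpace M]
    [ChartedSpace H M] [CompactSpace M] {n : ℕ} {S : Set (EuclideanSpace ℝ (Fin n))} (i : Fin n)
    (h : IsDiffeomorphicCopy I M {x ∈ S | 0 < x i})
    (hinv : ∀ x, coordReflection i x ∈ S ↔ x ∈ S) (hne : ∀ x ∈ S, x i ≠ 0) :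
    IsDiffeomorphicCopy I (M ⊕ M) S := by
  have h2 : IsDiffeomorphicCopy I M {x ∈ S | x i < 0} := by
    rw [← image_eq_of_forall_mem_iff (S := {x ∈ S | 0 < x i}) (T := {x ∈ S | x i < 0})
      (coordReflection i)]
    · exact h.image _
    · intro x
      simp [hinv, coordReflection_apply_self]
  convert h.sum h2 ?_
  · ext x
    constructor
    · intro hx
      rcases (hne x hx).lt_or_gt with h | h
      · exact Or.inr ⟨hx, h⟩
      · exact Or.inl ⟨hx, h⟩
    · rintro (hx | hx) <;> exact hx.1
  · rw [Set.disjoint_left]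
    rintro x ⟨_, hx⟩ ⟨_, hx'⟩
    exact lt_asymm hx hx'

/-! ### Tori and spheres among the level surfaces -/

theorem Circle.re_sq_add_im_sq (z : Circle) : (z : ℂ).re ^ 2 + (z : ℂ).im ^ 2 = 1 := by
  have := Circle.normSq_coe z
  rw [Complex.normSq_apply] at this
  linarith

theorem exists_circle_eq_mk {x y : ℝ} (h : x ^ 2 + y ^ 2 = 1) : ∃ z : Circle, (z : ℂ) = ⟨x, y⟩ := by
  refine ⟨⟨⟨x, y⟩, mem_sphere_zero_iff_norm.2 ?_⟩, rfl⟩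
  rw [Complex.norm_def, Complex.normSq_mk, Real.sqrt_eq_one]
  linarith

theorem Complex.contDiff_re {m : ℕ∞ω} : ContDiff ℝ m Complex.re := Complex.reCLM.contDiff

theorem Complex.contDiff_im {m : ℕ∞ω} : ContDiff ℝ m Complex.im := Complex.imCLM.contDiff

theorem differentiable_euclidean_apply {n : ℕ} (i : Fin n) :
    Differentiable ℝ fun x : EuclideanSpace ℝ (Fin n) => x i := by fun_prop

theorem exists_sqrt_mul_of_sq_add_sq {a x y : ℝ} (ha : 0 < a) (h : x ^ 2 + y ^ 2 = a) :
    ∃ z : Circle, x = √a * (z : ℂ).re ∧ y = √a * (z : ℂ).im := by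
  have hs : 0 < √a := Real.sqrt_pos.2 ha
  obtain ⟨z, hz⟩ := exists_circle_eq_mk (x := x / √a) (y := y / √a) (by
    rw [div_pow, div_pow, Real.sq_sqrt ha.le, ← add_div, h, div_self ha.ne'])
  refine ⟨z, ?_, ?_⟩ <;> rw [hz] <;> field_simp

/-- The pairs (m₁, γ₁) and (m₂, γ₂) run independently over circles of radii √a and √b. Since γ₁² +
γ₂² ≤ a + b < 1, γ₃ is the smooth positive root of 1 - γ₁² - γ₂². -/
theorem isDiffeomorphicCopy_torus_of_add_lt_one {a b : ℝ} (ha : 0 < a) (hb : 0 < b)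
    (hab : a + b < 1) :
    IsDiffeomorphicCopy ((𝓡 1).prod (𝓡 1)) Torus2 {x ∈ suslovSurface 1 1 a b | 0 < x 4} := by
  have hsa : 0 < √a := Real.sqrt_pos.2 ha
  have hsb : 0 < √b := Real.sqrt_pos.2 hb
  have hpos : ∀ p : Torus2, 0 < 1 - (√a * (p.1 : ℂ).im) ^ 2 - (√b * (p.2 : ℂ).im) ^ 2 := by
    intro p
    have h1 := Circle.re_sq_add_im_sq p.1
    have h2 := Circle.re_sq_add_im_sq p.2
    rw [mul_pow, mul_pow, Real.sq_sqrt ha.le, Real.sq_sqrt hb.le]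
    nlinarith [sq_nonneg (p.1 : ℂ).re, sq_nonneg (p.2 : ℂ).re]
  refine .of_leftInverse contMDiff_torusInclusion injective_torusInclusion
    injective_mfderiv_torusInclusion
    (fun v => !₂[√a * v.1.re, √b * v.2.re, √a * v.1.im, √b * v.2.im,
      √(1 - (√a * v.1.im) ^ 2 - (√b * v.2.im) ^ 2)])
    (fun x => ((√a)⁻¹ • (x 0 + x 2 * Complex.I), (√b)⁻¹ • (x 1 + x 3 * Complex.I)))
    (fun p => ?_) (fun p => ?_) (fun p => ?_) ?_
  · have hre := Complex.contDiff_re (m := ∞)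
    have him := Complex.contDiff_im (m := ∞)
    rw [contDiffAt_euclidean]
    intro i
    fin_cases i
    · exact (contDiff_const.mul (hre.comp contDiff_fst)).contDiffAt
    · exact (contDiff_const.mul (hre.comp contDiff_snd)).contDiffAt
    · exact (contDiff_const.mul (him.comp contDiff_fst)).contDiffAt
    · exact (contDiff_const.mul (him.comp contDiff_snd)).contDiffAt
    · refine ContDiffAt.sqrt (ContDiff.contDiffAt ?_) (hpos p).ne'
      exact (contDiff_const.sub ((contDiff_const.mul (him.comp contDiff_fst)).pow 2)).sub
        ((contDiff_const.mul (him.comp contDiff_snd)).pow 2)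
  · have hc : Differentiable ℝ Complex.ofReal := Complex.ofRealCLM.differentiable
    have h := fun i => hc.comp (differentiable_euclidean_apply (n := 5) i)
    refine DifferentiableAt.prodMk (DifferentiableAt.fun_const_smul ?_ _)
      (DifferentiableAt.fun_const_smul ?_ _)
    · exact ((h 0).add ((h 2).mul_const _)) _
    · exact ((h 1).add ((h 3).mul_const _)) _
  · refine Filter.Eventually.of_forall fun v => ?_
    refine Prod.ext (Complex.ext ?_ ?_) (Complex.ext ?_ ?_) <;> simp [hsa.ne', hsb.ne']
  · ext x
    constructor
    · rintro ⟨p, rfl⟩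
      have h1 := Circle.re_sq_add_im_sq p.1
      have h2 := Circle.re_sq_add_im_sq p.2
      have h3 := hpos p
      simp only [suslovSurface, torusInclusion, Function.comp_apply, Set.mem_ofPred_eq,
        Matrix.cons_val]
      refine ⟨⟨?_, ?_, ?_⟩, Real.sqrt_pos.2 h3⟩
      · rw [mul_pow, mul_pow, Real.sq_sqrt ha.le]
        linear_combination a * h1
      · rw [mul_pow, mul_pow, Real.sq_sqrt hb.le]
        linear_combination b * h2
      · rw [Real.sq_sqrt h3.le]
        ring
    · rintro ⟨⟨h1, h2, h3⟩, h4⟩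
      rw [one_mul] at h1 h2
      obtain ⟨z, hz1, hz2⟩ := exists_sqrt_mul_of_sq_add_sq ha h1
      obtain ⟨w, hw1, hw2⟩ := exists_sqrt_mul_of_sq_add_sq hb h2
      refine ⟨(z, w), ?_⟩
      ext i
      fin_cases i
      · exact hz1.symm
      · exact hw1.symm
      · exact hz2.symm
      · exact hw2.symm
      · simp only [torusInclusion, Function.comp_apply, PiLp.toLp_apply]
        simp [← hz2, ← hw2]
        rw [← h3, ← Real.sqrt_sq h4.le]
        congr 1
        ring_nf
        rw [Real.sqrt_sq h4.le]

/-- The pair (m₂, γ₂) runs over a circle of radius √b. As b < 1, over each of its points (γ₁, γ₃)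
runs over a circle of positive radius √(1 - γ₂²). As a > 1 ≥ γ₁², m₁ is a smooth positive root. -/
theorem isDiffeomorphicCopy_torus_of_one_lt_of_lt_one {a b : ℝ} (ha : 1 < a) (hb : 0 < b)
    (hb1 : b < 1) :
    IsDiffeomorphicCopy ((𝓡 1).prod (𝓡 1)) Torus2 {x ∈ suslovSurface 1 1 a b | 0 < x 0} := by
  have hsb : 0 < √b := Real.sqrt_pos.2 hb
  have hpos : ∀ p : Torus2, 0 < 1 - (√b * (p.2 : ℂ).im) ^ 2 := by
    intro p
    have h2 := Circle.re_sq_add_im_sq p.2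
    rw [mul_pow, Real.sq_sqrt hb.le]
    nlinarith [sq_nonneg (p.2 : ℂ).re]
  have hpos' : ∀ p : Torus2, 0 < a - (√(1 - (√b * (p.2 : ℂ).im) ^ 2) * (p.1 : ℂ).re) ^ 2 := by
    intro p
    have h1 := Circle.re_sq_add_im_sq p.1
    rw [mul_pow, Real.sq_sqrt (hpos p).le]
    have := mul_nonneg (sq_nonneg (√b * (p.2 : ℂ).im)) (sq_nonneg (p.1 : ℂ).re)
    nlinarith [sq_nonneg (p.1 : ℂ).im]
  refine .of_leftInverse contMDiff_torusInclusion injective_torusInclusion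
    injective_mfderiv_torusInclusion
    (fun v => !₂[√(a - (√(1 - (√b * v.2.im) ^ 2) * v.1.re) ^ 2), √b * v.2.re,
      √(1 - (√b * v.2.im) ^ 2) * v.1.re, √b * v.2.im, √(1 - (√b * v.2.im) ^ 2) * v.1.im])
    (fun x => ((√(1 - x 3 ^ 2))⁻¹ • (x 2 + x 4 * Complex.I), (√b)⁻¹ • (x 1 + x 3 * Complex.I)))
    (fun p => ?_) (fun p => ?_) (fun p => ?_) ?_
  · have hre := Complex.contDiff_re (m := ∞)
    have him := Complex.contDiff_im (m := ∞)
    have hr : ContDiffAt ℝ ∞ (fun v : ℂ × ℂ => √(1 - (√b * v.2.im) ^ 2)) (torusInclusion p) :=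
      ContDiffAt.sqrt (contDiff_const.sub
        ((contDiff_const.mul (him.comp contDiff_snd)).pow 2)).contDiffAt (hpos p).ne'
    rw [contDiffAt_euclidean]
    intro i
    fin_cases i
    · refine ContDiffAt.sqrt ?_ (hpos' p).ne'
      exact contDiffAt_const.sub ((hr.mul (hre.comp contDiff_fst).contDiffAt).pow 2)
    · exact (contDiff_const.mul (hre.comp contDiff_snd)).contDiffAt
    · exact hr.mul (hre.comp contDiff_fst).contDiffAt
    · exact (contDiff_const.mul (him.comp contDiff_snd)).contDiffAt
    · exact hr.mul (him.comp contDiff_fst).contDiffAt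
  · have hc : Differentiable ℝ Complex.ofReal := Complex.ofRealCLM.differentiable
    have h := fun i => hc.comp (differentiable_euclidean_apply (n := 5) i)
    have h3 := differentiable_euclidean_apply (n := 5) 3
    refine DifferentiableAt.prodMk (DifferentiableAt.fun_smul ?_ ?_)
      (DifferentiableAt.fun_const_smul ?_ _)
    · refine DifferentiableAt.inv (DifferentiableAt.sqrt ?_ (hpos p).ne')
        (Real.sqrt_pos.2 (hpos p)).ne'
      exact ((differentiable_const _).sub (h3.pow 2)) _
    · exact ((h 2).add ((h 4).mul_const _)) _
    · exact ((h 1).add ((h 3).mul_const _)) _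
  -- The left inverse divides by the radius √(1 - γ₂²), so the identity is available only on the
  -- open set where this radius is positive.
  · have hopen : IsOpen {v : ℂ × ℂ | 0 < 1 - (√b * v.2.im) ^ 2} :=
      isOpen_lt continuous_const (by fun_prop)
    filter_upwards [hopen.mem_nhds (hpos p)] with v hv
    have := (Real.sqrt_pos.2 hv).ne'
    refine Prod.ext (Complex.ext ?_ ?_) (Complex.ext ?_ ?_) <;> simp [this, hsb.ne']
  · ext x
    constructor
    · rintro ⟨p, rfl⟩
      have h1 := Circle.re_sq_add_im_sq p.1
      have h2 := Circle.re_sq_add_im_sq p.2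
      have h3 := hpos p
      have h4 := hpos' p
      simp only [suslovSurface, torusInclusion, Function.comp_apply, Set.mem_ofPred_eq,
        Matrix.cons_val]
      refine ⟨⟨?_, ?_, ?_⟩, Real.sqrt_pos.2 h4⟩
      · rw [Real.sq_sqrt h4.le]
        ring
      · rw [mul_pow, mul_pow, Real.sq_sqrt hb.le]
        linear_combination b * h2
      · rw [mul_pow _ (p.1 : ℂ).re, mul_pow _ (p.1 : ℂ).im, Real.sq_sqrt h3.le]
        linear_combination (1 - (√b * (p.2 : ℂ).im) ^ 2) * h1
    · rintro ⟨⟨h1, h2, h3⟩, h4⟩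
      rw [one_mul] at h1 h2
      obtain ⟨w, hw1, hw2⟩ := exists_sqrt_mul_of_sq_add_sq hb h2
      have hlt : 0 < 1 - x 3 ^ 2 := by nlinarith [sq_nonneg (x 1)]
      obtain ⟨z, hz1, hz2⟩ := exists_sqrt_mul_of_sq_add_sq (x := x 2) (y := x 4) hlt (by linarith)
      refine ⟨(z, w), ?_⟩
      rw [hw2] at hz1 hz2
      ext i
      fin_cases i
      · refine Eq.trans (b := √(a - x 2 ^ 2)) ?_ ?_
        · rw [hz1]
          rfl
        · rw [← h1, add_sub_cancel_right, Real.sqrt_sq h4.le]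
          rfl
      · exact hw1.symm
      · exact hz1.symm
      · exact hw2.symm
      · exact hz2.symm

/-- On the sphere of γ both a - γ₁² and b - γ₂² are positive, so m₁ and m₂ are smooth positive roots
over all of it. -/
theorem isDiffeomorphicCopy_sphere_of_one_lt {a b : ℝ} (ha : 1 < a) (hb : 1 < b) :
    IsDiffeomorphicCopy (𝓡 2) Sphere2
      {x ∈ {x ∈ suslovSurface 1 1 a b | 0 < x 0} | 0 < x 1} := by
  have hsph : ∀ p : Sphere2, (p : EuclideanSpace ℝ (Fin 3)) 0 ^ 2 +
      (p : EuclideanSpace ℝ (Fin 3)) 1 ^ 2 + (p : EuclideanSpace ℝ (Fin 3)) 2 ^ 2 = 1 := by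
    intro p
    have := EuclideanSpace.real_norm_sq_eq (p : EuclideanSpace ℝ (Fin 3))
    rw [mem_sphere_zero_iff_norm.1 p.2, Fin.sum_univ_three] at this
    linarith
  have hpa : ∀ p : Sphere2, 0 < a - (p : EuclideanSpace ℝ (Fin 3)) 0 ^ 2 := fun p => by
    nlinarith [hsph p, sq_nonneg ((p : EuclideanSpace ℝ (Fin 3)) 1),
      sq_nonneg ((p : EuclideanSpace ℝ (Fin 3)) 2)]
  have hpb : ∀ p : Sphere2, 0 < b - (p : EuclideanSpace ℝ (Fin 3)) 1 ^ 2 := fun p => by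
    nlinarith [hsph p, sq_nonneg ((p : EuclideanSpace ℝ (Fin 3)) 0),
      sq_nonneg ((p : EuclideanSpace ℝ (Fin 3)) 2)]
  have : Fact (Module.finrank ℝ (EuclideanSpace ℝ (Fin 3)) = 2 + 1) := ⟨by simp⟩
  refine .of_leftInverse (contMDiff_coe_sphere (n := 2)) Subtype.val_injective
    injective_mfderiv_coe_sphere2
    (fun v => !₂[√(a - v 0 ^ 2), √(b - v 1 ^ 2), v 0, v 1, v 2])
    (fun x => !₂[x 2, x 3, x 4]) (fun p => ?_) (fun p => ?_) (fun p => ?_) ?_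
  · have h : ∀ i, ContDiff ℝ ∞ fun v : EuclideanSpace ℝ (Fin 3) => v i := fun i => by fun_prop
    rw [contDiffAt_euclidean]
    intro i
    fin_cases i
    · exact ContDiffAt.sqrt (contDiff_const.sub ((h 0).pow 2)).contDiffAt (hpa p).ne'
    · exact ContDiffAt.sqrt (contDiff_const.sub ((h 1).pow 2)).contDiffAt (hpb p).ne'
    · exact (h 0).contDiffAt
    · exact (h 1).contDiffAt
    · exact (h 2).contDiffAt
  · rw [differentiableAt_euclidean]
    intro i
    fin_cases i <;> exact differentiable_euclidean_apply _ _
  · refine Filter.Eventually.of_forall fun v => ?_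
    ext i
    fin_cases i <;> rfl
  · ext x
    constructor
    · rintro ⟨p, rfl⟩
      simp only [suslovSurface, Function.comp_apply, Set.mem_ofPred_eq,
        Matrix.cons_val]
      refine ⟨⟨⟨?_, ?_, hsph p⟩, Real.sqrt_pos.2 (hpa p)⟩, Real.sqrt_pos.2 (hpb p)⟩
      · rw [Real.sq_sqrt (hpa p).le]
        ring
      · rw [Real.sq_sqrt (hpb p).le]
        ring
    · rintro ⟨⟨⟨h1, h2, h3⟩, h4⟩, h5⟩
      refine ⟨⟨!₂[x 2, x 3, x 4], ?_⟩, ?_⟩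
      · rw [mem_sphere_zero_iff_norm, ← sq_eq_sq₀ (norm_nonneg _) zero_le_one,
          EuclideanSpace.real_norm_sq_eq, Fin.sum_univ_three]
        simpa using h3
      · ext i
        fin_cases i
        · refine Eq.trans (b := √(a - x 2 ^ 2)) rfl ?_
          rw [← h1, one_mul, add_sub_cancel_right, Real.sqrt_sq h4.le]
          rfl
        · refine Eq.trans (b := √(b - x 3 ^ 2)) rfl ?_
          rw [← h2, one_mul, add_sub_cancel_right, Real.sqrt_sq h5.le]
          rfl
        · rfl
        · rfl
        · rfl

theorem isDiffeomorphicCopy_of_add_lt_one {a b : ℝ} (ha : 0 < a) (hb : 0 < b) (hab : a + b < 1) :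
    IsDiffeomorphicCopy ((𝓡 1).prod (𝓡 1)) (Torus2 ⊕ Torus2) (suslovSurface 1 1 a b) := by
  refine (isDiffeomorphicCopy_torus_of_add_lt_one ha hb hab).double 4
    (coordReflection_mem_suslovSurface_iff 4) ?_
  rintro x ⟨h1, h2, h3⟩ h
  nlinarith [sq_nonneg (x 0), sq_nonneg (x 1)]

theorem isDiffeomorphicCopy_of_one_lt_of_lt_one {a b : ℝ} (ha : 1 < a) (hb : 0 < b) (hb1 : b < 1) :
    IsDiffeomorphicCopy ((𝓡 1).prod (𝓡 1)) (Torus2 ⊕ Torus2) (suslovSurface 1 1 a b) := by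
  refine (isDiffeomorphicCopy_torus_of_one_lt_of_lt_one ha hb hb1).double 0
    (coordReflection_mem_suslovSurface_iff 0) ?_
  rintro x ⟨h1, h2, h3⟩ h
  nlinarith [sq_nonneg (x 3), sq_nonneg (x 4)]

/-- Exchanging (m₁, γ₁) with (m₂, γ₂) swaps the roles of a and b. -/
theorem isDiffeomorphicCopy_of_lt_one_of_one_lt {a b : ℝ} (ha : 0 < a) (ha1 : a < 1) (hb : 1 < b) :
    IsDiffeomorphicCopy ((𝓡 1).prod (𝓡 1)) (Torus2 ⊕ Torus2) (suslovSurface 1 1 a b) := by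
  let e : Equiv.Perm (Fin 5) := Equiv.swap 0 1 * Equiv.swap 2 3
  let L := (LinearIsometryEquiv.piLpCongrLeft 2 ℝ ℝ e).toContinuousLinearEquiv
  have hL : ∀ x i, L x i = x (e.symm i) := fun x i => by
    simp [L, LinearIsometryEquiv.piLpCongrLeft_apply]
  rw [← image_eq_of_forall_mem_iff (S := suslovSurface 1 1 b a) (T := suslovSurface 1 1 a b) L]
  · exact (isDiffeomorphicCopy_of_one_lt_of_lt_one hb ha ha1).image L
  · intro x
    have e0 : e.symm 0 = 1 := by decide
    have e1 : e.symm 1 = 0 := by decide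
    have e2 : e.symm 2 = 3 := by decide
    have e3 : e.symm 3 = 2 := by decide
    have e4 : e.symm 4 = 4 := by decide
    simp only [suslovSurface, Set.mem_ofPred_eq, hL, e0, e1, e2, e3, e4, add_comm (x 3 ^ 2)]
    tauto

theorem isDiffeomorphicCopy_of_one_lt_of_one_lt {a b : ℝ} (ha : 1 < a) (hb : 1 < b) :
    IsDiffeomorphicCopy (𝓡 2) ((Sphere2 ⊕ Sphere2) ⊕ (Sphere2 ⊕ Sphere2))
      (suslovSurface 1 1 a b) := by
  refine IsDiffeomorphicCopy.double 0 ((isDiffeomorphicCopy_sphere_of_one_lt ha hb).double 1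
    (fun x => ?_) ?_) (coordReflection_mem_suslovSurface_iff 0) ?_
  · rw [Set.mem_ofPred_eq, Set.mem_ofPred_eq, coordReflection_mem_suslovSurface_iff,
      coordReflection_apply_of_ne (by decide)]
  · rintro x ⟨⟨h1, h2, h3⟩, -⟩ h
    nlinarith [sq_nonneg (x 2), sq_nonneg (x 4)]
  · rintro x ⟨h1, h2, h3⟩ h
    nlinarith [sq_nonneg (x 3), sq_nonneg (x 4)]

/-! ### Regular level sets are embedded submanifolds -/

section RegularLevelSet

variable {V F G : Type*} [NormedAddCommGroup V] [NormedSpace ℝ V]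
  [NormedAddCommGroup F] [NormedSpace ℝ F] [NormedAddCommGroup G] [NormedSpace ℝ G]

/-- A chart of the subset `S` of a vector space that is the restriction of a smooth map and has a
smooth inverse. -/
def IsSmoothSubsetChart {S : Set V} (e : OpenPartialHomeomorph S G) : Prop :=
  (∃ P : V → G, ContDiff ℝ ∞ P ∧ ∀ y : S, e y = P y) ∧
    ContDiffOn ℝ ∞ (fun v => (e.symm v : V)) e.target

/-- A surjective linear map is completed to an isomorphism by a map to a space of the right
dimension. -/
theorem exists_equiv_prod_of_surjective [FiniteDimensional ℝ V] [FiniteDimensional ℝ F]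
    [FiniteDimensional ℝ G] (A : V →L[ℝ] F) (hA : Function.Surjective A)
    (hd : Module.finrank ℝ V = Module.finrank ℝ F + Module.finrank ℝ G) :
    ∃ (P : V →L[ℝ] G) (L : V ≃L[ℝ] F × G), (L : V →L[ℝ] F × G) = A.prod P := by
  have h1 := LinearMap.finrank_range_add_finrank_ker A.toLinearMap
  rw [LinearMap.range_eq_top.2 hA, finrank_top] at h1
  have h2 : Module.finrank ℝ A.toLinearMap.ker = Module.finrank ℝ G := by omega
  -- A projection onto the kernel of `A`, followed by an isomorphism of the kernel with `G`, detects
  -- exactly the directions lost by `A`.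
  let k := LinearEquiv.ofFinrankEq _ _ h2
  obtain ⟨π, hπ⟩ := LinearMap.exists_leftInverse_of_injective A.toLinearMap.ker.subtype
    (Submodule.ker_subtype _)
  let P : V →L[ℝ] G := LinearMap.toContinuousLinearMap (k.toLinearMap ∘ₗ π)
  have hinj : Function.Injective (A.prod P).toLinearMap := by
    rw [injective_iff_map_eq_zero]
    intro v hv
    obtain ⟨hv1, hv2⟩ := Prod.ext_iff.1 hv
    have hv3 : π v = 0 := k.map_eq_zero_iff.1 hv2
    have hv4 := DFunLike.congr_fun hπ ⟨v, hv1⟩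
    have hv5 : π v = ⟨v, hv1⟩ := hv4
    rw [hv3] at hv5
    exact (congrArg Subtype.val hv5).symm
  refine ⟨P, (LinearEquiv.ofInjectiveOfFinrankEq (A.prod P).toLinearMap hinj
    (by rw [Module.finrank_prod, hd])).toContinuousLinearEquiv, ?_⟩
  ext v <;> rfl

/-- Charts of a regular level set, obtained from the inverse function theorem. -/
theorem exists_isSmoothSubsetChart [FiniteDimensional ℝ V] [FiniteDimensional ℝ F]
    [FiniteDimensional ℝ G] {f : V → F} (hf : ContDiff ℝ ∞ f) (c : F)
    (hd : Module.finrank ℝ V = Module.finrank ℝ F + Module.finrank ℝ G)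
    (x : {x | f x = c}) (hx : Function.Surjective (fderiv ℝ f x)) :
    ∃ e : OpenPartialHomeomorph {x | f x = c} G, x ∈ e.source ∧ IsSmoothSubsetChart e := by
  have : CompleteSpace V := FiniteDimensional.complete ℝ V
  obtain ⟨P, L, hL⟩ := exists_equiv_prod_of_surjective (G := G) (fderiv ℝ f x) hx hd
  let g : V → F × G := fun y => (f y, P y)
  have hg : ContDiff ℝ ∞ g := hf.prodMk P.contDiff
  have hgd : HasFDerivAt g (L : V →L[ℝ] F × G) x := by
    rw [hL]
    exact ((hf.differentiable (by simp)) _).hasFDerivAt.prodMk P.hasFDerivAt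
  let φ₀ := hg.contDiffAt.toOpenPartialHomeomorph g hgd (by simp)
  -- Restricting to points with invertible differential makes the local inverse smooth on its whole
  -- target, not only at the image of `x`.
  have hU : IsOpen {y | fderiv ℝ g y ∈ Set.range ((↑) : (V ≃L[ℝ] F × G) → V →L[ℝ] F × G)} :=
    (ContinuousLinearEquiv.isOpen).preimage (hg.continuous_fderiv (by simp))
  let φ := φ₀.restrOpen _ hU
  have hφ : ∀ y, φ y = (f y, P y) := fun y => rfl
  have hxφ : (x : V) ∈ φ.source :=
    ⟨hg.contDiffAt.mem_toOpenPartialHomeomorph_source hgd (by simp), L, hgd.fderiv.symm⟩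
  have hsymm : ContDiffOn ℝ ∞ φ.symm φ.target := by
    intro v hv
    obtain ⟨A, hA⟩ := (φ.map_target hv).2
    refine (φ.contDiffAt_symm hv (f₀' := A) ?_ hg.contDiffAt).contDiffWithinAt
    rw [hA]
    exact ((hg.differentiable (by simp)) _).hasFDerivAt
  have hlev : ∀ v, (c, v) ∈ φ.target → f (φ.symm (c, v)) = c := fun v hv =>
    congrArg Prod.fst ((hφ _).symm.trans (φ.right_inv hv))
  have hproj : ∀ v, (c, v) ∈ φ.target → P (φ.symm (c, v)) = v := fun v hv =>
    congrArg Prod.snd ((hφ _).symm.trans (φ.right_inv hv))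
  have hval : ∀ y : {x | f x = c}, φ y = (c, P y) := fun y => by rw [hφ, y.2]
  classical
  have hto : IsOpen {v : G | (c, v) ∈ φ.target} := φ.open_target.preimage (by fun_prop)
  let e : OpenPartialHomeomorph {x | f x = c} G :=
    { toFun := fun y => P y
      invFun := fun v => if h : (c, v) ∈ φ.target then ⟨φ.symm (c, v), hlev v h⟩ else x
      source := Subtype.val ⁻¹' φ.source
      target := {v | (c, v) ∈ φ.target}
      map_source' := fun y hy => by
        have := φ.map_source hy
        rwa [hval] at this
      map_target' := fun v hv => by
        rw [dif_pos (show (c, v) ∈ φ.target from hv)]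
        exact φ.map_target hv
      left_inv' := fun y hy => by
        have h1 := φ.map_source hy
        rw [hval] at h1
        rw [dif_pos h1]
        apply Subtype.ext
        change φ.symm (c, P y) = y
        rw [← hval]
        exact φ.left_inv hy
      right_inv' := fun v hv => by
        rw [dif_pos (show (c, v) ∈ φ.target from hv)]
        exact hproj v hv
      open_source := φ.open_source.preimage continuous_subtype_val
      open_target := hto
      continuousOn_toFun := (P.continuous.comp continuous_subtype_val).continuousOn
      continuousOn_invFun := by
        rw [Topology.IsInducing.subtypeVal.continuousOn_iff]
        refine (φ.continuousOn_symm.comp (f := fun v : G => (c, v)) (by fun_prop)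
          fun v hv => hv).congr fun v hv => ?_
        rw [Function.comp_apply, dif_pos (show (c, v) ∈ φ.target from hv)]
        rfl }
  refine ⟨e, hxφ, ⟨P, P.contDiff, fun y => rfl⟩, ?_⟩
  refine (hsymm.comp (f := fun v : G => (c, v)) (by fun_prop) fun v hv => hv).congr fun v hv => ?_
  change ((if h : (c, v) ∈ φ.target then ⟨φ.symm (c, v), hlev v h⟩ else x : {x | f x = c}) : V) = _
  rw [dif_pos (show (c, v) ∈ φ.target from hv)]
  rfl

end RegularLevelSet

/-- Charts as in `IsSmoothSubsetChart` around all points make the subset an embedded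
submanifold. -/
theorem exists_isManifold_of_isSmoothSubsetChart {n d : ℕ}
    {S : Set (EuclideanSpace ℝ (Fin n))}
    (h : ∀ x : S, ∃ e : OpenPartialHomeomorph S (EuclideanSpace ℝ (Fin d)),
      x ∈ e.source ∧ IsSmoothSubsetChart e) :
    ∃ _ : ChartedSpace (EuclideanSpace ℝ (Fin d)) S,
      IsManifold (𝓡 d) ∞ S ∧ IsDiffeomorphicCopy (𝓡 d) S S := by
  choose e hes he using h
  let C : ChartedSpace (EuclideanSpace ℝ (Fin d)) S :=
    { atlas := Set.range e
      chartAt := e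
      mem_chart_source := hes
      chart_mem_atlas := fun x => ⟨x, rfl⟩ }
  have hM : IsManifold (𝓡 d) ∞ S := by
    apply isManifold_of_contDiffOn
    rintro _ _ ⟨x, rfl⟩ ⟨y, rfl⟩
    obtain ⟨⟨P, hP, hPe⟩, -⟩ := he y
    have h1 := hP.comp_contDiffOn (he x).2
    simp only [modelWithCornersSelf_coe, modelWithCornersSelf_coe_symm, Function.id_comp,
      Function.comp_id, Set.preimage_id, Set.range_id, Set.inter_univ]
    refine (h1.mono ?_).congr fun v _ => ?_
    · exact fun v hv => hv.1
    · exact hPe _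
  have hsm : ContMDiff (𝓡 d) (𝓡 n) ∞ (Subtype.val : S → EuclideanSpace ℝ (Fin n)) := by
    intro x
    rw [contMDiffAt_iff]
    refine ⟨continuous_subtype_val.continuousAt, ?_⟩
    have h2 : ContDiffAt ℝ ∞ (fun v => ((e x).symm v : EuclideanSpace ℝ (Fin n))) (e x x) :=
      (he x).2.contDiffAt ((e x).open_target.mem_nhds ((e x).map_source (hes x)))
    exact h2.contDiffWithinAt
  refine ⟨C, hM, Subtype.val, hsm, fun x => ?_, Topology.IsEmbedding.subtypeVal,
    Subtype.range_val⟩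
  obtain ⟨⟨P, hP, hPe⟩, -⟩ := he x
  -- The chart has invertible differential and factors through the inclusion, whose differential is
  -- therefore injective.
  have h3 : (extChartAt (𝓡 d) x : S → EuclideanSpace ℝ (Fin d)) = P ∘ Subtype.val :=
    funext hPe
  have h4 := (isInvertible_mfderiv_extChartAt (I := 𝓡 d) (mem_extChartAt_source (I := 𝓡 d) x))
  rw [h3, mfderiv_comp (I' := 𝓡 n) x (hP.contMDiff.mdifferentiable (by simp) _)
    (hsm.mdifferentiable (by simp) _)] at h4
  obtain ⟨A, hA⟩ := h4
  have h5 : Function.Injective ⇑(A : TangentSpace (𝓡 d) x →L[ℝ]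
    TangentSpace (𝓡 d) ((P ∘ Subtype.val) x)) := A.injective
  rw [hA] at h5
  exact Function.Injective.of_comp (f := mfderiv (𝓡 n) (𝓡 d) P x) h5

/-- A regular level set in `ℝⁿ` is an embedded submanifold. -/
theorem exists_isManifold_levelSet {F : Type*} [NormedAddCommGroup F] [NormedSpace ℝ F]
    [FiniteDimensional ℝ F] {n d : ℕ}
    {f : EuclideanSpace ℝ (Fin n) → F} (hf : ContDiff ℝ ∞ f) (c : F)
    (hd : n = Module.finrank ℝ F + d)
    (hreg : ∀ x, f x = c → Function.Surjective (fderiv ℝ f x)) :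
    ∃ _ : ChartedSpace (EuclideanSpace ℝ (Fin d)) {x | f x = c},
      IsManifold (𝓡 d) ∞ {x | f x = c} ∧ IsDiffeomorphicCopy (𝓡 d) {x | f x = c} {x | f x = c} :=
  exists_isManifold_of_isSmoothSubsetChart fun x =>
    exists_isSmoothSubsetChart hf c (by simpa using hd) x (hreg x x.2)

/-! ### The level surface as a manifold -/

/-- The three functions that define the level surfaces for `b₁ = b₂ = 1`. -/
def suslovMap (x : EuclideanSpace ℝ (Fin 5)) : ℝ × ℝ × ℝ :=
  (x 0 ^ 2 + 1 * x 2 ^ 2, x 1 ^ 2 + 1 * x 3 ^ 2, x 2 ^ 2 + x 3 ^ 2 + x 4 ^ 2)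

theorem setOf_suslovMap_eq (a b : ℝ) : {x | suslovMap x = (a, b, 1)} = suslovSurface 1 1 a b := by
  ext x
  simp [suslovMap, suslovSurface, Prod.ext_iff]

theorem contDiff_suslovMap : ContDiff ℝ ∞ suslovMap := by
  have h : ∀ i, ContDiff ℝ ∞ fun v : EuclideanSpace ℝ (Fin 5) => v i := fun i => by fun_prop
  refine ContDiff.prodMk ?_ (ContDiff.prodMk ?_ ?_)
  · exact ((h 0).pow 2).add (contDiff_const.mul ((h 2).pow 2))
  · exact ((h 1).pow 2).add (contDiff_const.mul ((h 3).pow 2))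
  · exact (((h 2).pow 2).add ((h 3).pow 2)).add ((h 4).pow 2)

theorem fderiv_suslovMap_apply (x v : EuclideanSpace ℝ (Fin 5)) :
    fderiv ℝ suslovMap x v = (2 * x 0 * v 0 + 2 * x 2 * v 2, 2 * x 1 * v 1 + 2 * x 3 * v 3,
      2 * x 2 * v 2 + 2 * x 3 * v 3 + 2 * x 4 * v 4) := by
  have h : ∀ i, HasFDerivAt (fun y : EuclideanSpace ℝ (Fin 5) => y i ^ 2)
      ((2 * x i) • (EuclideanSpace.proj i : EuclideanSpace ℝ (Fin 5) →L[ℝ] ℝ)) x := fun i => by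
    have := ((EuclideanSpace.proj i : EuclideanSpace ℝ (Fin 5) →L[ℝ] ℝ).hasFDerivAt (x := x)).pow 2
    simpa using this
  have h2 : HasFDerivAt suslovMap _ x :=
    ((h 0).add ((h 2).const_mul 1)).prodMk
      (((h 1).add ((h 3).const_mul 1)).prodMk (((h 2).add (h 3)).add (h 4)))
  rw [h2.fderiv]
  simp

/-- The points of the level surfaces over the region `D₂` are regular. -/
theorem surjective_fderiv_suslovMap {a b : ℝ} (ha1 : a < 1) (hb1 : b < 1)
    (hab : 1 < a + b) {x : EuclideanSpace ℝ (Fin 5)} (hx : suslovMap x = (a, b, 1)) :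
    Function.Surjective (fderiv ℝ suslovMap x) := by
  obtain ⟨h1, h2, h3⟩ : x ∈ suslovSurface 1 1 a b := by rwa [← setOf_suslovMap_eq]
  rw [one_mul] at h1 h2
  rintro ⟨p, q, r⟩
  have key : ∀ {s t : ℝ}, s ≠ 0 → ∃ u, 2 * s * u = t := fun {s t} hs =>
    ⟨t / (2 * s), by field_simp⟩
  simp only [fderiv_suslovMap_apply, Prod.mk.injEq]
  suffices h : ∃ v : Fin 5 → ℝ, 2 * x 0 * v 0 + 2 * x 2 * v 2 = p ∧
      2 * x 1 * v 1 + 2 * x 3 * v 3 = q ∧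
      2 * x 2 * v 2 + 2 * x 3 * v 3 + 2 * x 4 * v 4 = r by
    obtain ⟨v, hv⟩ := h
    exact ⟨WithLp.toLp 2 v, hv⟩
  -- Vanishing coordinates correspond to sides of the pentagon, and only adjacent sides meet. In
  -- each case the nonzero coordinates provide three pivots, and the system is solved triangularly.
  by_cases h0 : x 0 = 0
  · have hx2 : x 2 ≠ 0 := by rintro h; rw [h0, h] at h1; linarith
    have hx1 : x 1 ≠ 0 := by
      intro h; rw [h0] at h1; rw [h] at h2; nlinarith [sq_nonneg (x 4)]
    obtain ⟨v2, hv2⟩ := key (t := p) hx2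
    by_cases h4 : x 4 = 0
    · have hx3 : x 3 ≠ 0 := by rintro h; rw [h0] at h1; rw [h, h4] at h3; linarith
      obtain ⟨v3, hv3⟩ := key (t := r - p) hx3
      obtain ⟨v1, hv1⟩ := key (t := q - (r - p)) hx1
      exact ⟨![0, v1, v2, v3, 0], by simp [*]⟩
    · obtain ⟨v4, hv4⟩ := key (t := r - p) h4
      obtain ⟨v1, hv1⟩ := key (t := q) hx1
      exact ⟨![0, v1, v2, 0, v4], by simp [*]⟩
  · by_cases hx1 : x 1 = 0
    · have hx3 : x 3 ≠ 0 := by rintro h; rw [hx1, h] at h2; linarith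
      obtain ⟨v3, hv3⟩ := key (t := q) hx3
      by_cases h4 : x 4 = 0
      · have hx2 : x 2 ≠ 0 := by rintro h; rw [hx1] at h2; rw [h, h4] at h3; linarith
        obtain ⟨v2, hv2⟩ := key (t := r - q) hx2
        obtain ⟨v0, hv0⟩ := key (t := p - (r - q)) h0
        exact ⟨![v0, 0, v2, v3, 0], by simp [*]⟩
      · obtain ⟨v4, hv4⟩ := key (t := r - q) h4
        obtain ⟨v0, hv0⟩ := key (t := p) h0
        exact ⟨![v0, 0, 0, v3, v4], by simp [*]⟩
    · by_cases h4 : x 4 = 0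
      · by_cases hx2 : x 2 = 0
        · have hx3 : x 3 ≠ 0 := by rintro h; rw [hx2, h, h4] at h3; norm_num at h3
          obtain ⟨v3, hv3⟩ := key (t := r) hx3
          obtain ⟨v0, hv0⟩ := key (t := p) h0
          obtain ⟨v1, hv1⟩ := key (t := q - r) hx1
          exact ⟨![v0, v1, 0, v3, 0], by simp [*]⟩
        · obtain ⟨v2, hv2⟩ := key (t := r) hx2
          obtain ⟨v0, hv0⟩ := key (t := p - r) h0
          obtain ⟨v1, hv1⟩ := key (t := q) hx1
          exact ⟨![v0, v1, v2, 0, 0], by simp [*]⟩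
      · obtain ⟨v4, hv4⟩ := key (t := r) h4
        obtain ⟨v0, hv0⟩ := key (t := p) h0
        obtain ⟨v1, hv1⟩ := key (t := q) hx1
        exact ⟨![v0, v1, 0, 0, v4], by simp [*]⟩

/-! ### Convex hulls and affine independence of indexed finite families -/

section IndexedFamilies

variable {ι V : Type*} [Fintype ι] [AddCommGroup V] [Module ℝ V] [DecidableEq V]

theorem mem_convexHull_finset_image_iff (f : ι → V) (τ : Finset ι) (x : V) :
    x ∈ convexHull ℝ (τ.image f : Set V) ↔ ∃ w : ι → ℝ, (∀ j, 0 ≤ w j) ∧ (∀ j, j ∉ τ → w j = 0) ∧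
      ∑ j, w j = 1 ∧ ∑ j, w j • f j = x := by
  classical
  constructor
  · intro hx
    have hconv : Convex ℝ {x | ∃ w : ι → ℝ, (∀ j, 0 ≤ w j) ∧ (∀ j, j ∉ τ → w j = 0) ∧
        ∑ j, w j = 1 ∧ ∑ j, w j • f j = x} := by
      rintro _ ⟨w, h1, h2, h3, rfl⟩ _ ⟨w', h1', h2', h3', rfl⟩ α β hα hβ hαβ
      refine ⟨fun j => α * w j + β * w' j, fun j => ?_, fun j hj => ?_, ?_, ?_⟩
      · exact add_nonneg (mul_nonneg hα (h1 j)) (mul_nonneg hβ (h1' j))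
      · dsimp only
        rw [h2 j hj, h2' j hj, mul_zero, mul_zero, add_zero]
      · rw [Finset.sum_add_distrib, ← Finset.mul_sum, ← Finset.mul_sum, h3, h3', mul_one, mul_one,
          hαβ]
      · simp only [add_smul, mul_smul, Finset.sum_add_distrib, Finset.smul_sum]
    refine convexHull_min ?_ hconv hx
    intro y hy
    obtain ⟨j, hj, rfl⟩ := Finset.mem_image.1 (Finset.mem_coe.1 hy)
    refine ⟨Pi.single j 1, fun k => ?_, fun k hk => ?_, by simp, ?_⟩
    · by_cases h : k = j
      · subst h
        simp
      · simp [h]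
    · rw [Pi.single_eq_of_ne]
      rintro rfl
      exact hk hj
    · simp [Pi.single_apply, ite_smul]
  · rintro ⟨w, h1, h2, h3, rfl⟩
    have e1 : ∑ j ∈ τ, w j = 1 := by
      rw [← h3]
      exact Finset.sum_subset (Finset.subset_univ _) fun j _ hj => h2 j hj
    have e2 : ∑ j ∈ τ, w j • f j = ∑ j, w j • f j :=
      Finset.sum_subset (Finset.subset_univ _) fun j _ hj => by rw [h2 j hj, zero_smul]
    rw [← e2]
    exact (convex_convexHull ℝ _).sum_mem (fun j _ => h1 j) e1 fun j hj =>
      subset_convexHull ℝ _ (Finset.mem_coe.2 (Finset.mem_image_of_mem f hj))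

theorem affineIndependent_finset_image (f : ι → V) (τ : Finset ι)
    (h : ∀ w : ι → ℝ, (∀ j, j ∉ τ → w j = 0) → ∑ j, w j = 0 → ∑ j, w j • f j = 0 → w = 0) :
    AffineIndependent ℝ ((↑) : ↥(τ.image f) → V) := by
  classical
  have h1 : AffineIndependent ℝ fun j : τ => f j := by
    rw [affineIndependent_iff_of_fintype]
    intro w hw hs
    rw [Finset.univ.weightedVSub_eq_linear_combination hw] at hs
    have h2 := h (fun j => if hj : j ∈ τ then w ⟨j, hj⟩ else 0) (fun j hj => dif_neg hj) ?_ ?_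
    · intro i
      have := congrFun h2 i
      simpa using this
    · refine Eq.trans ?_ hw
      rw [← Finset.sum_subset (Finset.subset_univ τ) fun j _ hj => dif_neg hj,
        ← Finset.sum_coe_sort τ]
      exact Finset.sum_congr rfl fun j _ => by simp
    · refine Eq.trans ?_ hs
      rw [← Finset.sum_subset (Finset.subset_univ τ) fun j _ hj => by
        rw [dif_neg hj, zero_smul], ← Finset.sum_coe_sort τ]
      exact Finset.sum_congr rfl fun j _ => by simp
  refine h1.range.mono (s := ((τ.image f : Finset V) : Set V)) ?_
  intro y hy
  obtain ⟨j, hj, rfl⟩ := Finset.mem_image.1 (Finset.mem_coe.1 hy)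
  exact ⟨⟨j, hj⟩, rfl⟩

end IndexedFamilies

/-! ### The pentagon -/

/-- The vertices of the pentagon `0 ≤ s ≤ a`, `0 ≤ t ≤ b`, `s + t ≤ 1` in cyclic order, given by
the values of the five functions `a - s`, `b - t`, `s`, `t`, `1 - s - t`. -/
def pentagonVertex (a b : ℝ) : Fin 5 → Fin 5 → ℝ :=
  ![![a, b, 0, 0, 1], ![0, b, a, 0, 1 - a], ![0, a + b - 1, a, 1 - a, 0],
    ![a + b - 1, 0, 1 - b, b, 0], ![a, 0, 0, b, 1 - b]]

/-- The edges of the pentagon that do not contain a given vertex. -/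
def offEdge : Fin 5 → Fin 5 → Bool :=
  ![![true, true, false, false, true], ![false, true, true, false, true],
    ![false, true, true, true, false], ![true, false, true, true, false],
    ![true, false, false, true, true]]

/-- The faces of the triangulation of the pentagon by its two diagonals at the vertex `0`. -/
def pentagonFaces : Finset (Finset (Fin 5)) :=
  {τ | τ.Nonempty ∧ (τ ⊆ {0, 1, 2} ∨ τ ⊆ {0, 2, 3} ∨ τ ⊆ {0, 3, 4})}

/-- The parameters for which the cross-section of the level surface is a pentagon. -/
structure IsPentagonal (a b : ℝ) : Prop where
  pos_left : 0 < a
  pos_right : 0 < b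
  left_lt_one : a < 1
  right_lt_one : b < 1
  one_lt_add : 1 < a + b

section Pentagon

variable {a b : ℝ}

theorem pentagonVertex_pos (h : IsPentagonal a b) {j i : Fin 5} (hji : offEdge j i = true) :
    0 < pentagonVertex a b j i := by
  obtain ⟨h1, h2, h3, h4, h5⟩ := h
  fin_cases j <;> fin_cases i <;> simp [offEdge] at hji <;> simp [pentagonVertex] <;> linarith

theorem pentagonVertex_eq_zero {j i : Fin 5} (hji : offEdge j i = false) :
    pentagonVertex a b j i = 0 := by
  fin_cases j <;> fin_cases i <;> simp [offEdge] at hji <;> simp [pentagonVertex]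

theorem pentagonVertex_nonneg (h : IsPentagonal a b) (j i : Fin 5) :
    0 ≤ pentagonVertex a b j i := by
  cases hji : offEdge j i
  · exact (pentagonVertex_eq_zero hji).ge
  · exact (pentagonVertex_pos h hji).le

theorem pentagonVertex_pos_iff (h : IsPentagonal a b) {j i : Fin 5} :
    0 < pentagonVertex a b j i ↔ offEdge j i = true := by
  refine ⟨fun hp => ?_, pentagonVertex_pos h⟩
  by_contra hji
  exact hp.ne' (pentagonVertex_eq_zero (by simpa using hji))

theorem offEdge_injective : Function.Injective offEdge := by decide

/-- The three linear relations between the coordinates of points of the pentagon. -/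
theorem sum_mul_pentagonVertex (w : Fin 5 → ℝ) (hw : ∑ j, w j = 1) :
    ∑ j, w j * pentagonVertex a b j 0 + ∑ j, w j * pentagonVertex a b j 2 = a ∧
    ∑ j, w j * pentagonVertex a b j 1 + ∑ j, w j * pentagonVertex a b j 3 = b ∧
    ∑ j, w j * pentagonVertex a b j 2 + ∑ j, w j * pentagonVertex a b j 3 +
      ∑ j, w j * pentagonVertex a b j 4 = 1 := by
  simp only [Fin.sum_univ_five] at hw ⊢
  simp only [pentagonVertex, Matrix.cons_val]
  refine ⟨?_, ?_, ?_⟩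
  · linear_combination a * hw
  · linear_combination b * hw
  · linear_combination hw

theorem weights_eq_zero_of_mem_pentagonFaces {τ : Finset (Fin 5)} (hτ : τ ∈ pentagonFaces)
    {w : Fin 5 → ℝ} (hw : ∀ j, j ∉ τ → w j = 0) :
    (w 3 = 0 ∧ w 4 = 0) ∨ (w 1 = 0 ∧ w 4 = 0) ∨ (w 1 = 0 ∧ w 2 = 0) := by
  have key : ∀ τ ∈ pentagonFaces,
      (3 ∉ τ ∧ 4 ∉ τ) ∨ (1 ∉ τ ∧ 4 ∉ τ) ∨ (1 ∉ τ ∧ 2 ∉ τ) := by decide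
  rcases key τ hτ with ⟨h1, h2⟩ | ⟨h1, h2⟩ | ⟨h1, h2⟩
  · exact Or.inl ⟨hw _ h1, hw _ h2⟩
  · exact Or.inr (Or.inl ⟨hw _ h1, hw _ h2⟩)
  · exact Or.inr (Or.inr ⟨hw _ h1, hw _ h2⟩)

/-- A point of the pentagon has at most one system of barycentric coordinates with respect to the
triangulation. -/
theorem weights_unique (h : IsPentagonal a b) {w w' : Fin 5 → ℝ} (hw : ∀ j, 0 ≤ w j)
    (hw' : ∀ j, 0 ≤ w' j) (h1 : ∑ j, w j = 1) (h1' : ∑ j, w' j = 1)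
    (hz : (w 3 = 0 ∧ w 4 = 0) ∨ (w 1 = 0 ∧ w 4 = 0) ∨ (w 1 = 0 ∧ w 2 = 0))
    (hz' : (w' 3 = 0 ∧ w' 4 = 0) ∨ (w' 1 = 0 ∧ w' 4 = 0) ∨ (w' 1 = 0 ∧ w' 2 = 0))
    (h2 : ∑ j, w j * pentagonVertex a b j 2 = ∑ j, w' j * pentagonVertex a b j 2)
    (h3 : ∑ j, w j * pentagonVertex a b j 3 = ∑ j, w' j * pentagonVertex a b j 3) : w = w' := by
  obtain ⟨ha, hb, ha1, hb1, hab⟩ := h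
  have hA : 0 < a * (1 - a) := mul_pos ha (by linarith)
  have hB : 0 < b * (1 - b) := mul_pos hb (by linarith)
  have hC : 0 < a + b - 1 := by linarith
  have hD : 0 < a * b := mul_pos ha hb
  simp only [Fin.sum_univ_five] at h1 h1' h2 h3
  simp only [pentagonVertex, Matrix.cons_val] at h2 h3
  -- the equations of the two diagonals
  have hu : a * (1 - a) * w 1 - (a + b - 1) * w 3 - a * b * w 4 =
      a * (1 - a) * w' 1 - (a + b - 1) * w' 3 - a * b * w' 4 := by
    linear_combination (1 - a) * h2 - a * h3
  have hv : b * (1 - b) * w 4 - (a + b - 1) * w 2 - a * b * w 1 =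
      b * (1 - b) * w' 4 - (a + b - 1) * w' 2 - a * b * w' 1 := by
    linear_combination (1 - b) * h3 - b * h2
  -- The function in `hu` vanishes at vertices 0 and 2, is positive at 1 and negative at 3 and 4.
  -- Its positive part is therefore a(1 - a) times the weight of vertex 1, whichever triangle is
  -- used. The other diagonal treats vertex 4 likewise.
  have e1 : w 1 = w' 1 := by
    have := mul_nonneg hA.le (hw 1)
    have := mul_nonneg hA.le (hw' 1)
    have := mul_nonneg hC.le (hw 3)
    have := mul_nonneg hC.le (hw' 3)
    have := mul_nonneg hD.le (hw 4)
    have := mul_nonneg hD.le (hw' 4)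
    have h0 : w 1 = 0 ∨ (w 3 = 0 ∧ w 4 = 0) := by tauto
    have h0' : w' 1 = 0 ∨ (w' 3 = 0 ∧ w' 4 = 0) := by tauto
    apply mul_left_cancel₀ hA.ne'
    rcases h0 with h0 | ⟨h0, h0b⟩ <;> rcases h0' with h0' | ⟨h0', h0b'⟩ <;>
      simp only [*, mul_zero] at * <;> linarith
  have e4 : w 4 = w' 4 := by
    have := mul_nonneg hB.le (hw 4)
    have := mul_nonneg hB.le (hw' 4)
    have := mul_nonneg hC.le (hw 2)
    have := mul_nonneg hC.le (hw' 2)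
    have := mul_nonneg hD.le (hw 1)
    have := mul_nonneg hD.le (hw' 1)
    have h0 : w 4 = 0 ∨ (w 1 = 0 ∧ w 2 = 0) := by tauto
    have h0' : w' 4 = 0 ∨ (w' 1 = 0 ∧ w' 2 = 0) := by tauto
    apply mul_left_cancel₀ hB.ne'
    rcases h0 with h0 | ⟨h0, h0b⟩ <;> rcases h0' with h0' | ⟨h0', h0b'⟩ <;>
      simp only [*, mul_zero] at * <;> linarith
  have e3 : w 3 = w' 3 := by
    apply mul_left_cancel₀ hC.ne'
    rw [e1, e4] at hu
    linarith
  have e2 : w 2 = w' 2 := by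
    apply mul_left_cancel₀ hC.ne'
    rw [e1, e4] at hv
    linarith
  have e0 : w 0 = w' 0 := by linarith
  ext j
  fin_cases j <;> assumption

/-- The vertices of a triangle of the triangulation are affinely independent. -/
theorem weights_eq_zero (h : IsPentagonal a b) {w : Fin 5 → ℝ} (h1 : ∑ j, w j = 0)
    (hz : (w 3 = 0 ∧ w 4 = 0) ∨ (w 1 = 0 ∧ w 4 = 0) ∨ (w 1 = 0 ∧ w 2 = 0))
    (h2 : ∑ j, w j * pentagonVertex a b j 2 = 0)
    (h3 : ∑ j, w j * pentagonVertex a b j 3 = 0) : w = 0 := by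
  obtain ⟨ha, hb, ha1, hb1, hab⟩ := h
  have hA : 0 < a * (1 - a) := mul_pos ha (by linarith)
  have hB : 0 < b * (1 - b) := mul_pos hb (by linarith)
  have hC : 0 < a + b - 1 := by linarith
  simp only [Fin.sum_univ_five] at h1 h2 h3
  simp only [pentagonVertex, Matrix.cons_val] at h2 h3
  have hu : a * (1 - a) * w 1 - (a + b - 1) * w 3 - a * b * w 4 = 0 := by
    linear_combination (1 - a) * h2 - a * h3
  have hv : b * (1 - b) * w 4 - (a + b - 1) * w 2 - a * b * w 1 = 0 := by
    linear_combination (1 - b) * h3 - b * h2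
  have key : w 1 = 0 ∧ w 2 = 0 ∧ w 3 = 0 ∧ w 4 = 0 := by
    rcases hz with ⟨z1, z2⟩ | ⟨z1, z2⟩ | ⟨z1, z2⟩
    · have e1 : w 1 = 0 := by simpa [z1, z2, ha.ne', (sub_pos.2 ha1).ne'] using hu
      exact ⟨e1, by simpa [z2, e1, hC.ne'] using hv, z1, z2⟩
    · exact ⟨z1, by simpa [z1, z2, hC.ne'] using hv, by simpa [z1, z2, hC.ne'] using hu, z2⟩
    · have e4 : w 4 = 0 := by simpa [z1, z2, hb.ne', (sub_pos.2 hb1).ne'] using hv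
      exact ⟨z1, z2, by simpa [z1, e4, hC.ne'] using hu, e4⟩
  obtain ⟨e1, e2, e3, e4⟩ := key
  have e0 : w 0 = 0 := by linarith
  ext j
  fin_cases j <;> assumption

/-- Every point of the pentagon lies in a triangle of the triangulation. -/
theorem exists_weights (h : IsPentagonal a b) {s t : ℝ} (hs : 0 ≤ s) (ht : 0 ≤ t) (hsa : s ≤ a)
    (htb : t ≤ b) (hst : s + t ≤ 1) :
    ∃ τ ∈ pentagonFaces, ∃ w : Fin 5 → ℝ, (∀ j, 0 ≤ w j) ∧ (∀ j, j ∉ τ → w j = 0) ∧ ∑ j, w j = 1 ∧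
      ∑ j, w j * pentagonVertex a b j 2 = s ∧ ∑ j, w j * pentagonVertex a b j 3 = t := by
  obtain ⟨ha, hb, ha1, hb1, hab⟩ := h
  have hA : 0 < 1 - a := by linarith
  have hB : 0 < 1 - b := by linarith
  have hC : 0 < a + b - 1 := by linarith
  simp only [Fin.sum_univ_five]
  simp only [pentagonVertex, Matrix.cons_val]
  -- The signs of the two diagonal functions select the triangle; the weights are the barycentric
  -- coordinates in it.
  rcases le_total (a * t) ((1 - a) * s) with hu | hu
  · refine ⟨{0, 1, 2}, by decide,
      ![1 - s / a, ((1 - a) * s - a * t) / (a * (1 - a)), t / (1 - a), 0, 0], ?_, ?_, ?_, ?_, ?_⟩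
    · have h0 : s / a ≤ 1 := (div_le_one ha).2 hsa
      have h1 : 0 ≤ ((1 - a) * s - a * t) / (a * (1 - a)) :=
        div_nonneg (by linarith) (mul_pos ha hA).le
      have h2 : 0 ≤ t / (1 - a) := div_nonneg ht hA.le
      intro j
      fin_cases j <;> simp [*]
    · intro j
      fin_cases j <;> simp
    all_goals
      simp only [Matrix.cons_val]
      field_simp
      ring
  · rcases le_total (b * s) ((1 - b) * t) with hv | hv
    · refine ⟨{0, 3, 4}, by decide,
        ![1 - t / b, 0, 0, s / (1 - b), ((1 - b) * t - b * s) / (b * (1 - b))], ?_, ?_, ?_, ?_, ?_⟩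
      · have h0 : t / b ≤ 1 := (div_le_one hb).2 htb
        have h1 : 0 ≤ ((1 - b) * t - b * s) / (b * (1 - b)) :=
          div_nonneg (by linarith) (mul_pos hb hB).le
        have h2 : 0 ≤ s / (1 - b) := div_nonneg hs hB.le
        intro j
        fin_cases j <;> simp [*]
      · intro j
        fin_cases j <;> simp
      all_goals
        simp only [Matrix.cons_val]
        field_simp
        ring
    · refine ⟨{0, 2, 3}, by decide,
        ![1 - s - t, 0, (b * s - (1 - b) * t) / (a + b - 1),
          (a * t - (1 - a) * s) / (a + b - 1), 0],
        ?_, ?_, ?_, ?_, ?_⟩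
      · have h1 : 0 ≤ (b * s - (1 - b) * t) / (a + b - 1) := div_nonneg (by linarith) hC.le
        have h2 : 0 ≤ (a * t - (1 - a) * s) / (a + b - 1) := div_nonneg (by linarith) hC.le
        have h0 : 0 ≤ 1 - s - t := by linarith
        intro j
        fin_cases j
        exacts [h0, le_rfl, h1, h2, le_rfl]
      · intro j
        fin_cases j <;> simp
      all_goals
        simp only [Matrix.cons_val]
        field_simp
        ring

end Pentagon

/-! ### The polyhedral model of the level surface -/

/-- The polyhedral surface obtained by reflecting the pentagon in the coordinate hyperplanes. -/
def polyhedralSurface (a b : ℝ) : Set (EuclideanSpace ℝ (Fin 5)) :=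
  {y | |y 0| + |y 2| = a ∧ |y 1| + |y 3| = b ∧ |y 2| + |y 3| + |y 4| = 1}

/-- The mirror images of the vertices of the pentagon. -/
noncomputable def signedVertex (a b : ℝ) (σ : Fin 5 → ℤˣ) (j : Fin 5) : EuclideanSpace ℝ (Fin 5) :=
  WithLp.toLp 2 fun i => ((σ i : ℤ) : ℝ) * pentagonVertex a b j i

theorem abs_units_int_cast (u : ℤˣ) : |((u : ℤ) : ℝ)| = 1 := by
  rcases Int.units_eq_one_or u with rfl | rfl <;> simp

theorem units_int_cast_mul_self (u : ℤˣ) : ((u : ℤ) : ℝ) * ((u : ℤ) : ℝ) = 1 := by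
  rcases Int.units_eq_one_or u with rfl | rfl <;> simp

theorem units_int_cast_mul_right_inj {u v : ℤˣ} {t : ℝ} (ht : 0 < t)
    (h : ((u : ℤ) : ℝ) * t = ((v : ℤ) : ℝ) * t) : u = v := by
  have := mul_right_cancel₀ ht.ne' h
  exact Units.ext (by exact_mod_cast this)

/-- The sign of a real number, with the convention that the sign of zero is `1`. -/
noncomputable def unitSign (t : ℝ) : ℤˣ := if t < 0 then -1 else 1

theorem unitSign_mul_abs (t : ℝ) : ((unitSign t : ℤ) : ℝ) * |t| = t := by
  unfold unitSign
  split_ifs with h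
  · simp [abs_of_neg h]
  · simp [abs_of_nonneg (not_lt.1 h)]

theorem unitSign_mul_pos (u : ℤˣ) {t : ℝ} (ht : 0 < t) : unitSign (((u : ℤ) : ℝ) * t) = u := by
  rcases Int.units_eq_one_or u with rfl | rfl
  · simp [unitSign, ht.le]
  · simp [unitSign, ht]

section Triangulation

variable {a b : ℝ}

theorem signedVertex_apply (σ : Fin 5 → ℤˣ) (j i : Fin 5) :
    signedVertex a b σ j i = ((σ i : ℤ) : ℝ) * pentagonVertex a b j i := rfl

theorem abs_signedVertex_apply (h : IsPentagonal a b) (σ : Fin 5 → ℤˣ) (j i : Fin 5) :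
    |signedVertex a b σ j i| = pentagonVertex a b j i := by
  rw [signedVertex_apply, abs_mul, abs_units_int_cast, one_mul,
    abs_of_nonneg (pentagonVertex_nonneg h j i)]

/-- The absolute values of the coordinates identify the vertex, and a sign is invisible exactly
where its coordinate vanishes, that is, on the sides through the vertex. This governs all gluings.
-/
theorem signedVertex_eq_iff (h : IsPentagonal a b) {σ σ' : Fin 5 → ℤˣ} {j j' : Fin 5} :
    signedVertex a b σ j = signedVertex a b σ' j' ↔
      j = j' ∧ ∀ i, offEdge j i = true → σ i = σ' i := by
  constructor
  · intro he
    have hjj : j = j' := by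
      apply offEdge_injective
      ext i
      rw [Bool.eq_iff_iff, ← pentagonVertex_pos_iff h, ← pentagonVertex_pos_iff h,
        ← abs_signedVertex_apply h σ, ← abs_signedVertex_apply h σ', he]
    subst hjj
    refine ⟨rfl, fun i hi => ?_⟩
    exact units_int_cast_mul_right_inj (pentagonVertex_pos h hi) (congrArg (fun x => x i) he)
  · rintro ⟨rfl, hσ⟩
    ext i
    rw [signedVertex_apply, signedVertex_apply]
    cases hi : offEdge j i
    · rw [pentagonVertex_eq_zero hi, mul_zero, mul_zero]
    · rw [hσ i hi]

theorem signedVertex_injective (h : IsPentagonal a b) (σ : Fin 5 → ℤˣ) :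
    Function.Injective (signedVertex a b σ) := fun _ _ he => ((signedVertex_eq_iff h).1 he).1

theorem sum_smul_signedVertex_apply (σ : Fin 5 → ℤˣ) (w : Fin 5 → ℝ) (i : Fin 5) :
    (∑ j, w j • signedVertex a b σ j) i =
      ((σ i : ℤ) : ℝ) * ∑ j, w j * pentagonVertex a b j i := by
  simp only [WithLp.ofLp_sum, WithLp.ofLp_smul, Finset.sum_apply, Pi.smul_apply, smul_eq_mul,
    signedVertex_apply, Finset.mul_sum]
  exact Finset.sum_congr rfl fun j _ => by ring

theorem sum_mul_pentagonVertex_nonneg (h : IsPentagonal a b) {w : Fin 5 → ℝ} (hw : ∀ j, 0 ≤ w j)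
    (i : Fin 5) : 0 ≤ ∑ j, w j * pentagonVertex a b j i :=
  Finset.sum_nonneg fun j _ => mul_nonneg (hw j) (pentagonVertex_nonneg h j i)

/-- All vertices with pattern `σ` lie in one closed orthant, so nothing cancels: taking absolute
values folds the simplex back onto the pentagon with the same weights. -/
theorem abs_sum_smul_signedVertex_apply (h : IsPentagonal a b) (σ : Fin 5 → ℤˣ) {w : Fin 5 → ℝ}
    (hw : ∀ j, 0 ≤ w j) (i : Fin 5) :
    |(∑ j, w j • signedVertex a b σ j) i| = ∑ j, w j * pentagonVertex a b j i := by
  rw [sum_smul_signedVertex_apply, abs_mul, abs_units_int_cast, one_mul,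
    abs_of_nonneg (sum_mul_pentagonVertex_nonneg h hw i)]

open Classical in
/-- The simplex with sign pattern `σ` over a face of the triangulated pentagon. -/
noncomputable def signedFace (a b : ℝ) (q : Finset (Fin 5) × (Fin 5 → ℤˣ)) :
    Finset (EuclideanSpace ℝ (Fin 5)) :=
  q.1.image (signedVertex a b q.2)

/-- The triangulation of the polyhedral surface. -/
noncomputable def polyhedralComplex (h : IsPentagonal a b) :
    Geometry.SimplicialComplex ℝ (EuclideanSpace ℝ (Fin 5)) where
  faces := {s | ∃ τ ∈ pentagonFaces, ∃ σ, s = signedFace a b (τ, σ)}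
  isRelLowerSet_faces := by
    classical
    rintro _ ⟨τ, hτ, σ, rfl⟩
    have hτ' := hτ
    rw [pentagonFaces, Finset.mem_filter_univ] at hτ'
    refine ⟨hτ'.1.image _, fun t ht hne => ?_⟩
    obtain ⟨ρ, hρ, rfl⟩ := Finset.subset_image_iff.1 (show t ⊆ τ.image _ from ht)
    refine ⟨ρ, ?_, σ, rfl⟩
    rw [pentagonFaces, Finset.mem_filter_univ]
    exact ⟨Finset.image_nonempty.1 hne, hτ'.2.imp (Finset.Subset.trans hρ)
      (Or.imp (Finset.Subset.trans hρ) (Finset.Subset.trans hρ))⟩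
  indep := by
    classical
    rintro _ ⟨τ, hτ, σ, rfl⟩
    refine affineIndependent_finset_image _ _ fun w hw h1 h2 => ?_
    have h3 : ∀ i, ∑ j, w j * pentagonVertex a b j i = 0 := fun i => by
      have h4 := sum_smul_signedVertex_apply (a := a) (b := b) σ w i
      rw [h2] at h4
      have h5 := congrArg (fun t => ((σ i : ℤ) : ℝ) * t) h4
      simpa [← mul_assoc, units_int_cast_mul_self] using h5.symm
    exact weights_eq_zero h h1 (weights_eq_zero_of_mem_pentagonFaces hτ hw) (h3 2) (h3 3)
  inter_subset_convexHull := by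
    classical
    rintro _ _ ⟨τ, hτ, σ, rfl⟩ ⟨τ', hτ', σ', rfl⟩ x ⟨hx, hx'⟩
    rw [signedFace, mem_convexHull_finset_image_iff] at hx hx'
    obtain ⟨w, hw, hwτ, hw1, rfl⟩ := hx
    obtain ⟨w', hw', hwτ', hw1', he⟩ := hx'
    have habs : ∀ i, ∑ j, w' j * pentagonVertex a b j i = ∑ j, w j * pentagonVertex a b j i :=
      fun i => by
        rw [← abs_sum_smul_signedVertex_apply h σ hw, ← he,
          abs_sum_smul_signedVertex_apply h σ' hw']
    have hww : w' = w := weights_unique h hw' hw hw1' hw1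
      (weights_eq_zero_of_mem_pentagonFaces hτ' hwτ')
      (weights_eq_zero_of_mem_pentagonFaces hτ hwτ) (habs 2) (habs 3)
    subst hww
    have hsub : ∑ j ∈ Finset.univ.filter (fun j => w' j ≠ 0), w' j • signedVertex a b σ j =
        ∑ j, w' j • signedVertex a b σ j :=
      Finset.sum_filter_of_ne fun j _ hj h0 => hj (by rw [h0, zero_smul])
    rw [← hsub]
    refine (convex_convexHull ℝ _).sum_mem (fun j _ => hw j) ?_ fun j hj => ?_
    · rw [← hw1]
      exact Finset.sum_filter_of_ne fun j _ hj => hj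
    · have hj0 : w' j ≠ 0 := (Finset.mem_filter.1 hj).2
      have hjτ : j ∈ τ := by_contra fun hn => hj0 (hwτ j hn)
      have hjτ' : j ∈ τ' := by_contra fun hn => hj0 (hwτ' j hn)
      -- Where a vertex of positive weight has a nonzero coordinate, so does the common point, and
      -- its sign there forces the two patterns to agree.
      have hsv : signedVertex a b σ j = signedVertex a b σ' j := by
        refine (signedVertex_eq_iff h).2 ⟨rfl, fun i hi => ?_⟩
        have hpos : 0 < ∑ j, w' j * pentagonVertex a b j i :=
          Finset.sum_pos' (fun j _ => mul_nonneg (hw j) (pentagonVertex_nonneg h j i))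
            ⟨j, Finset.mem_univ _, mul_pos ((hw j).lt_of_ne' hj0) (pentagonVertex_pos h hi)⟩
        apply units_int_cast_mul_right_inj hpos
        rw [← sum_smul_signedVertex_apply, ← sum_smul_signedVertex_apply, he]
      refine subset_convexHull ℝ _ ⟨?_, ?_⟩
      · exact Finset.mem_coe.2 (Finset.mem_image_of_mem _ hjτ)
      · rw [hsv]
        exact Finset.mem_coe.2 (Finset.mem_image_of_mem _ hjτ')

theorem mem_faces_polyhedralComplex_iff (h : IsPentagonal a b)
    {s : Finset (EuclideanSpace ℝ (Fin 5))} : s ∈ (polyhedralComplex h).faces ↔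
      ∃ τ ∈ pentagonFaces, ∃ σ, s = signedFace a b (τ, σ) := Iff.rfl

/-- The complex triangulates the polyhedral surface. -/
theorem space_polyhedralComplex (h : IsPentagonal a b) :
    (polyhedralComplex h).space = polyhedralSurface a b := by
  classical
  ext y
  rw [Geometry.SimplicialComplex.mem_space_iff]
  constructor
  · rintro ⟨_, ⟨τ, hτ, σ, rfl⟩, hy⟩
    rw [signedFace, mem_convexHull_finset_image_iff] at hy
    obtain ⟨w, hw, -, hw1, rfl⟩ := hy
    rw [polyhedralSurface, Set.mem_ofPred_eq]
    simp only [abs_sum_smul_signedVertex_apply h σ hw]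
    exact sum_mul_pentagonVertex w hw1
  · rintro ⟨h1, h2, h3⟩
    obtain ⟨τ, hτ, w, hw, hwτ, hw1, hs, ht⟩ := exists_weights h (abs_nonneg (y 2))
      (abs_nonneg (y 3)) (by linarith [abs_nonneg (y 0)]) (by linarith [abs_nonneg (y 1)])
      (by linarith [abs_nonneg (y 4)])
    obtain ⟨e1, e2, e3⟩ := sum_mul_pentagonVertex (a := a) (b := b) w hw1
    have key : ∀ i, ∑ j, w j * pentagonVertex a b j i = |y i| := by
      intro i
      fin_cases i
      · change ∑ j, w j * pentagonVertex a b j 0 = |y 0|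
        linarith
      · change ∑ j, w j * pentagonVertex a b j 1 = |y 1|
        linarith
      · exact hs
      · exact ht
      · change ∑ j, w j * pentagonVertex a b j 4 = |y 4|
        linarith
    refine ⟨signedFace a b (τ, fun i => unitSign (y i)), ⟨τ, hτ, _, rfl⟩, ?_⟩
    rw [signedFace, mem_convexHull_finset_image_iff]
    refine ⟨w, hw, hwτ, hw1, ?_⟩
    ext i
    rw [sum_smul_signedVertex_apply, key, unitSign_mul_abs]

/-! ### The Euler characteristic -/

/-- One sign pattern for each simplex of the complex. -/
def canonicalFaces : Finset (Finset (Fin 5) × (Fin 5 → ℤˣ)) :=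
  (pentagonFaces ×ˢ Finset.univ).filter fun q =>
    ∀ i, (∀ j ∈ q.1, offEdge j i = false) → q.2 i = 1

theorem card_signedFace (h : IsPentagonal a b) (q : Finset (Fin 5) × (Fin 5 → ℤˣ)) :
    (signedFace a b q).card = q.1.card := by
  classical
  exact Finset.card_image_of_injective _ (signedVertex_injective h _)

/-- The vertices of a simplex determine its face of the pentagon and every sign visible at some
vertex; the invisible signs are normalised to 1. -/
theorem injOn_signedFace (h : IsPentagonal a b) :
    Set.InjOn (signedFace a b) canonicalFaces := by
  classical
  have key : ∀ {τ τ' : Finset (Fin 5)} {σ σ' : Fin 5 → ℤˣ},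
      signedFace a b (τ, σ) = signedFace a b (τ', σ') →
      ∀ j ∈ τ, j ∈ τ' ∧ ∀ i, offEdge j i = true → σ i = σ' i := by
    intro τ τ' σ σ' he j hj
    have hmem : signedVertex a b σ j ∈ signedFace a b (τ', σ') := by
      rw [← he]
      exact Finset.mem_image_of_mem _ hj
    obtain ⟨j', hj', he'⟩ := Finset.mem_image.1 hmem
    obtain ⟨rfl, hσ⟩ := (signedVertex_eq_iff h).1 he'.symm
    exact ⟨hj', hσ⟩
  rintro ⟨τ, σ⟩ hq ⟨τ', σ'⟩ hq' he
  have hc := (Finset.mem_filter.1 (Finset.mem_coe.1 hq)).2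
  have hc' := (Finset.mem_filter.1 (Finset.mem_coe.1 hq')).2
  have hτ : τ = τ' := Finset.Subset.antisymm (fun j hj => (key he j hj).1)
    fun j hj => (key he.symm j hj).1
  subst hτ
  refine Prod.ext rfl (funext fun i => ?_)
  by_cases hi : ∀ j ∈ τ, offEdge j i = false
  · exact (hc i hi).trans (hc' i hi).symm
  · push Not at hi
    obtain ⟨j, hj, hji⟩ := hi
    exact (key he j hj).2 i (by simpa using hji)

open Classical in
theorem faces_polyhedralComplex_eq (h : IsPentagonal a b) :
    (polyhedralComplex h).faces = (canonicalFaces.image (signedFace a b) : Finset _) := by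
  ext s
  rw [mem_faces_polyhedralComplex_iff, Finset.mem_coe, Finset.mem_image]
  constructor
  · rintro ⟨τ, hτ, σ, rfl⟩
    refine ⟨(τ, fun i => if ∀ j ∈ τ, offEdge j i = false then 1 else σ i), ?_, ?_⟩
    · rw [canonicalFaces, Finset.mem_filter]
      exact ⟨Finset.mem_product.2 ⟨hτ, Finset.mem_univ _⟩, fun i hi => if_pos hi⟩
    · refine Finset.image_congr fun j hj => (signedVertex_eq_iff h).2 ⟨rfl, fun i hi => ?_⟩
      refine if_neg fun hn => ?_
      rw [hn j hj] at hi
      exact Bool.false_ne_true hi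
  · rintro ⟨⟨τ, σ⟩, hq, rfl⟩
    rw [canonicalFaces, Finset.mem_filter, Finset.mem_product] at hq
    exact ⟨τ, hq.1.1, σ, rfl⟩

theorem finite_faces_polyhedralComplex (h : IsPentagonal a b) :
    (polyhedralComplex h).faces.Finite := by
  classical
  rw [faces_polyhedralComplex_eq h]
  exact Finset.finite_toSet _

/-- The count is 5·8 = 40 vertices, 5·16 + 2·32 = 144 edges (sides and diagonals) and 3·32 = 96
triangles. -/
theorem sum_canonicalFaces :
    ∑ q ∈ canonicalFaces, (-1 : ℤ) ^ (q.1.card - 1) = -8 := by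
  rw [canonicalFaces, Finset.sum_filter, Finset.sum_product]
  decide +kernel

theorem simplicialEulerChar_polyhedralComplex (h : IsPentagonal a b)
    (hK : (polyhedralComplex h).faces.Finite) :
    simplicialEulerChar (polyhedralComplex h) hK = -8 := by
  classical
  have e : hK.toFinset = canonicalFaces.image (signedFace a b) := by
    rw [← Finset.coe_inj, Set.Finite.coe_toFinset, faces_polyhedralComplex_eq h]
  rw [simplicialEulerChar, e, Finset.sum_image (injOn_signedFace h), ← sum_canonicalFaces]
  exact Finset.sum_congr rfl fun q _ => by rw [card_signedFace h]

/-! ### Orientation -/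

/-- The index of the vertex of the pentagon of which a given point is a mirror image. -/
noncomputable def vertexIndex (a b : ℝ) (x : EuclideanSpace ℝ (Fin 5)) : Fin 5 :=
  open Classical in if h : ∃ j σ, signedVertex a b σ j = x then h.choose else 0

theorem vertexIndex_signedVertex (h : IsPentagonal a b) (σ : Fin 5 → ℤˣ) (j : Fin 5) :
    vertexIndex a b (signedVertex a b σ j) = j := by
  have he : ∃ j' σ', signedVertex a b σ' j' = signedVertex a b σ j := ⟨j, σ, rfl⟩
  rw [vertexIndex, dif_pos he]
  obtain ⟨σ', hσ'⟩ := he.choose_spec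
  exact ((signedVertex_eq_iff h).1 hσ').1

/-- The product of the signs of the coordinates. -/
noncomputable def orthantSign (x : EuclideanSpace ℝ (Fin 5)) : ℤˣ := ∏ i, unitSign (x i)

/-- The orientation of the triple `i, j, k` with respect to the cyclic order of the vertices. -/
def cyclicSign (i j k : Fin 5) : ℤˣ :=
  if (i < j ∧ j < k) ∨ (j < k ∧ k < i) ∨ (k < i ∧ i < j) then 1 else -1

/-- `i, j, k` are vertices of a triangle of the triangulated pentagon. -/
def IsPentagonTriangle (i j k : Fin 5) : Prop :=
  i ≠ j ∧ j ≠ k ∧ i ≠ k ∧ {i, j, k} ∈ pentagonFaces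

instance (i j k : Fin 5) : Decidable (IsPentagonTriangle i j k) :=
  inferInstanceAs (Decidable (_ ∧ _))

theorem exists_of_isTriangle (h : IsPentagonal a b) {x y z : EuclideanSpace ℝ (Fin 5)}
    (ht : IsTriangle (polyhedralComplex h) x y z) :
    ∃ σ i j k, IsPentagonTriangle i j k ∧ x = signedVertex a b σ i ∧ y = signedVertex a b σ j ∧
      z = signedVertex a b σ k := by
  classical
  obtain ⟨hxy, hyz, hxz, t, ⟨τ, hτ, σ, rfl⟩, he⟩ := ht
  have hmem : ∀ u ∈ ({x, y, z} : Set (EuclideanSpace ℝ (Fin 5))),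
      ∃ i ∈ τ, signedVertex a b σ i = u := by
    rw [← he]
    exact fun u hu => Finset.mem_image.1 (Finset.mem_coe.1 hu)
  obtain ⟨i, hi, rfl⟩ := hmem x (by simp)
  obtain ⟨j, hj, rfl⟩ := hmem y (by simp)
  obtain ⟨k, hk, rfl⟩ := hmem z (by simp)
  have hsub : ({i, j, k} : Finset (Fin 5)) ⊆ τ := by
    intro l hl
    simp only [Finset.mem_insert, Finset.mem_singleton] at hl
    rcases hl with rfl | rfl | rfl <;> assumption
  refine ⟨σ, i, j, k, ⟨?_, ?_, ?_, ?_⟩, rfl, rfl, rfl⟩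
  · rintro rfl
    exact hxy rfl
  · rintro rfl
    exact hyz rfl
  · rintro rfl
    exact hxz rfl
  · rw [pentagonFaces, Finset.mem_filter_univ] at hτ ⊢
    exact ⟨⟨i, by simp⟩, hτ.2.imp hsub.trans (Or.imp hsub.trans hsub.trans)⟩

/-- No side contains all three vertices of a triangle, so their sum has no zero coordinate and
reveals the whole sign pattern. -/
theorem offEdge_of_isPentagonTriangle :
    ∀ i j k, IsPentagonTriangle i j k → ∀ c, offEdge i c ∨ offEdge j c ∨ offEdge k c := by decide

theorem cyclicSign_swap : ∀ i j k, IsPentagonTriangle i j k →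
    cyclicSign j i k = -cyclicSign i j k ∧ cyclicSign i k j = -cyclicSign i j k := by decide

/-- An edge shared by two triangles of one pentagon is a diagonal. It lies on no side, so its
endpoints together show all five signs. -/
theorem cyclicSign_opposite : ∀ i j k l, IsPentagonTriangle i j k → IsPentagonTriangle i j l →
    k ≠ l → cyclicSign i j l = -cyclicSign i j k ∧ ∀ c, offEdge i c ∨ offEdge j c := by
  decide +kernel

/-- Two vertices have at most one side in common, so two mirror images glued along an edge differ in
one sign only. -/
theorem offEdge_pair : ∀ i j, i ≠ j → ∀ c c', ¬offEdge i c → ¬offEdge j c → ¬offEdge i c' →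
    ¬offEdge j c' → c = c' := by decide

theorem orthantSign_add (h : IsPentagonal a b) (σ : Fin 5 → ℤˣ) {i j k : Fin 5}
    (ht : IsPentagonTriangle i j k) :
    orthantSign (signedVertex a b σ i + signedVertex a b σ j + signedVertex a b σ k) =
      ∏ c, σ c := by
  refine Finset.prod_congr rfl fun c _ => ?_
  have e : (signedVertex a b σ i + signedVertex a b σ j + signedVertex a b σ k) c =
      ((σ c : ℤ) : ℝ) * (pentagonVertex a b i c + pentagonVertex a b j c +
        pentagonVertex a b k c) := by
    simp only [PiLp.add_apply, signedVertex_apply]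
    ring
  rw [e]
  apply unitSign_mul_pos
  have h1 := pentagonVertex_nonneg h i c
  have h2 := pentagonVertex_nonneg h j c
  have h3 := pentagonVertex_nonneg h k c
  rcases offEdge_of_isPentagonTriangle i j k ht c with hc | hc | hc <;>
    linarith [pentagonVertex_pos h hc]

/-- The orientation of a triangle: the orientation in the pentagon times the sign of the
reflection. -/
noncomputable def triangleSign (a b : ℝ) (x y z : EuclideanSpace ℝ (Fin 5)) : ℤˣ :=
  orthantSign (x + y + z) * cyclicSign (vertexIndex a b x) (vertexIndex a b y) (vertexIndex a b z)

theorem isCoherentlyOrientable_polyhedralComplex (h : IsPentagonal a b) :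
    IsCoherentlyOrientable (polyhedralComplex h) := by
  refine ⟨triangleSign a b, fun x y z ht => ?_, fun x y z w ht ht' hzw => ?_⟩
  · obtain ⟨σ, i, j, k, hp, rfl, rfl, rfl⟩ := exists_of_isTriangle h ht
    obtain ⟨h1, h2⟩ := cyclicSign_swap i j k hp
    simp only [triangleSign, vertexIndex_signedVertex h, h1, h2, mul_neg]
    rw [add_comm (signedVertex a b σ j), add_right_comm (signedVertex a b σ i)]
    exact ⟨rfl, rfl⟩
  · obtain ⟨σ, i, j, k, hp, rfl, rfl, rfl⟩ := exists_of_isTriangle h ht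
    obtain ⟨σ', i', j', l, hp', hi, hj, rfl⟩ := exists_of_isTriangle h ht'
    obtain ⟨rfl, hσi⟩ := (signedVertex_eq_iff h).1 hi
    obtain ⟨rfl, hσj⟩ := (signedVertex_eq_iff h).1 hj
    have e1 := orthantSign_add h σ hp
    have e2 := orthantSign_add h σ' hp'
    rw [← hi, ← hj] at e2
    simp only [triangleSign, vertexIndex_signedVertex h, e1, e2]
    -- Either the triangles are mirror images across a side, and the product of signs changes, or
    -- they lie in one pentagon across a diagonal, and the cyclic sign changes.
    by_cases hkl : k = l
    · subst hkl
      have hne : ∃ c, σ c ≠ σ' c := by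
        by_contra! hall
        exact hzw (by rw [funext hall])
      obtain ⟨c, hc⟩ := hne
      have hci : ¬offEdge i c := fun hn => hc (hσi c hn)
      have hcj : ¬offEdge j c := fun hn => hc (hσj c hn)
      have hrest : ∀ c' ∈ Finset.univ.erase c, σ' c' = σ c' := by
        intro c' hc'
        by_contra hne'
        exact (Finset.mem_erase.1 hc').1 (offEdge_pair i j hp.1 c' c
          (fun hn => hne' (hσi c' hn).symm) (fun hn => hne' (hσj c' hn).symm) hci hcj)
      have hneg : σ' c = -σ c := by
        rcases Int.units_eq_one_or (σ c) with h1 | h1 <;>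
          rcases Int.units_eq_one_or (σ' c) with h2 | h2 <;> simp_all
      rw [← Finset.mul_prod_erase _ σ (Finset.mem_univ c),
        ← Finset.mul_prod_erase _ σ' (Finset.mem_univ c), Finset.prod_congr rfl hrest, hneg,
        neg_mul, neg_mul]
    · obtain ⟨h1, h2⟩ := cyclicSign_opposite i j k l hp hp' hkl
      have hσ : σ = σ' := funext fun c => (h2 c).elim (hσi c) (hσj c)
      rw [h1, hσ, mul_neg]

end Triangulation

/-! ### The level surface is homeomorphic to the polyhedral surface -/

/-- The homeomorphism `x ↦ x |x|` of the real line. -/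
noncomputable def signedSquare : ℝ ≃ₜ ℝ where
  toFun x := x * |x|
  -- The square root of a negative number is 0, so at most one term is nonzero.
  invFun y := √y - √(-y)
  left_inv x := by
    rcases le_total 0 x with h | h
    · simp only [abs_of_nonneg h]
      rw [Real.sqrt_mul_self h, Real.sqrt_eq_zero_of_nonpos (by nlinarith), sub_zero]
    · simp only [abs_of_nonpos h]
      rw [Real.sqrt_eq_zero_of_nonpos (by nlinarith), mul_neg, neg_neg, ← neg_mul_neg,
        Real.sqrt_mul_self (neg_nonneg.2 h)]
      ring
  right_inv y := by
    rcases le_total 0 y with h | h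
    · simp only [Real.sqrt_eq_zero_of_nonpos (neg_nonpos.2 h), sub_zero,
        abs_of_nonneg (Real.sqrt_nonneg y), Real.mul_self_sqrt h]
    · simp only [Real.sqrt_eq_zero_of_nonpos h, zero_sub, abs_neg,
        abs_of_nonneg (Real.sqrt_nonneg (-y)), neg_mul, Real.mul_self_sqrt (neg_nonneg.2 h),
        neg_neg]
  continuous_toFun := by fun_prop
  continuous_invFun := by fun_prop

theorem abs_signedSquare (x : ℝ) : |signedSquare x| = x ^ 2 := by
  have h : signedSquare x = x * |x| := rfl
  rw [h, abs_mul, abs_abs, abs_mul_abs_self, sq]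

/-- The homeomorphism `x ↦ x |x|` in all coordinates. -/
noncomputable def signedSquarePi (n : ℕ) : EuclideanSpace ℝ (Fin n) ≃ₜ EuclideanSpace ℝ (Fin n) :=
  ((EuclideanSpace.equiv (Fin n) ℝ).toHomeomorph.trans
    (Homeomorph.piCongrRight fun _ => signedSquare)).trans
    (EuclideanSpace.equiv (Fin n) ℝ).symm.toHomeomorph

theorem abs_signedSquarePi_apply {n : ℕ} (x : EuclideanSpace ℝ (Fin n)) (i : Fin n) :
    |signedSquarePi n x i| = x i ^ 2 := abs_signedSquare (x i)

/-- The homeomorphism of the level surface with the polyhedral surface. -/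
noncomputable def suslovSurfaceHomeomorph (a b : ℝ) :
    suslovSurface 1 1 a b ≃ₜ polyhedralSurface a b :=
  (signedSquarePi 5).subtype fun x => by
    simp only [suslovSurface, polyhedralSurface, Set.mem_ofPred_eq, abs_signedSquarePi_apply,
      one_mul]

/-! ### Connectedness -/

section Connectedness

variable {a b : ℝ}

/-- Points of the polyhedral surface with the same signs of the coordinates can be joined. -/
theorem joinedIn_polyhedralSurface (σ : Fin 5 → ℤˣ) {x y : EuclideanSpace ℝ (Fin 5)}
    (hx : x ∈ polyhedralSurface a b) (hy : y ∈ polyhedralSurface a b)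
    (hσx : ∀ i, |x i| = ((σ i : ℤ) : ℝ) * x i) (hσy : ∀ i, |y i| = ((σ i : ℤ) : ℝ) * y i) :
    JoinedIn (polyhedralSurface a b) x y := by
  apply JoinedIn.of_segment_subset
  rintro _ ⟨α, β, hα, hβ, hαβ, rfl⟩
  have key : ∀ i, |(α • x + β • y) i| = α * |x i| + β * |y i| := by
    intro i
    have e : (α • x + β • y) i = ((σ i : ℤ) : ℝ) * (α * |x i| + β * |y i|) := by
      have : (α • x + β • y) i = α * x i + β * y i := rfl
      rw [this, hσx, hσy]
      linear_combination (-(α * x i + β * y i)) * units_int_cast_mul_self (σ i)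
    rw [e, abs_mul, abs_units_int_cast, one_mul, abs_of_nonneg (by positivity)]
  obtain ⟨h1, h2, h3⟩ := hx
  obtain ⟨h1', h2', h3'⟩ := hy
  simp only [polyhedralSurface, Set.mem_ofPred_eq, key]
  refine ⟨?_, ?_, ?_⟩
  · linear_combination α * h1 + β * h1' + a * hαβ
  · linear_combination α * h2 + β * h2' + b * hαβ
  · linear_combination α * h3 + β * h3' + hαβ

theorem signedVertex_mem_polyhedralSurface (h : IsPentagonal a b) (σ : Fin 5 → ℤˣ) (j : Fin 5) :
    signedVertex a b σ j ∈ polyhedralSurface a b := by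
  simp only [polyhedralSurface, Set.mem_ofPred_eq, abs_signedVertex_apply h]
  simpa [Pi.single_apply] using sum_mul_pentagonVertex (a := a) (b := b) (Pi.single j 1) (by simp)

theorem abs_signedVertex_eq_mul (h : IsPentagonal a b) (σ : Fin 5 → ℤˣ) (j i : Fin 5) :
    |signedVertex a b σ j i| = ((σ i : ℤ) : ℝ) * signedVertex a b σ j i := by
  rw [abs_signedVertex_apply h, signedVertex_apply, ← mul_assoc, units_int_cast_mul_self, one_mul]

/-- Moving in a cell to a vertex, one can change the signs of the coordinates that vanish there. -/
theorem joinedIn_signedVertex (h : IsPentagonal a b) {σ σ' : Fin 5 → ℤˣ} (j j' : Fin 5)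
    (hσ : ∀ i, offEdge j' i = true → σ i = σ' i) :
    JoinedIn (polyhedralSurface a b) (signedVertex a b σ j) (signedVertex a b σ' j') := by
  rw [← (signedVertex_eq_iff h).2 ⟨rfl, hσ⟩]
  exact joinedIn_polyhedralSurface σ (signedVertex_mem_polyhedralSurface h _ _)
    (signedVertex_mem_polyhedralSurface h _ _) (abs_signedVertex_eq_mul h _ _)
    (abs_signedVertex_eq_mul h _ _)

theorem isPathConnected_polyhedralSurface (h : IsPentagonal a b) :
    IsPathConnected (polyhedralSurface a b) := by
  refine ⟨signedVertex a b 1 0, signedVertex_mem_polyhedralSurface h _ _, fun {y} hy => ?_⟩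
  refine JoinedIn.symm ?_
  have h1 : JoinedIn (polyhedralSurface a b) y (signedVertex a b (fun i => unitSign (y i)) 0) :=
    joinedIn_polyhedralSurface _ hy (signedVertex_mem_polyhedralSurface h _ _)
      (fun i => by
        conv_rhs => rw [← unitSign_mul_abs (y i), unitSign_mul_abs (y i)]
        nth_rw 3 [← unitSign_mul_abs (y i)]
        rw [← mul_assoc, units_int_cast_mul_self, one_mul])
      (abs_signedVertex_eq_mul h _ _)
  generalize (fun i => unitSign (y i)) = σ at h1
  refine h1.trans ?_
  -- Vertex 0 lies on sides 2 and 3, vertex 2 on sides 0 and 4, vertex 4 on sides 1 and 2. Visiting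
  -- these three resets all five signs to 1.
  refine (joinedIn_signedVertex h (σ' := ![σ 0, σ 1, 1, 1, σ 4]) 0 0 ?_).trans ?_
  · intro i
    fin_cases i <;> simp [offEdge]
  refine (joinedIn_signedVertex h (σ' := ![1, σ 1, 1, 1, 1]) 0 2 ?_).trans ?_
  · intro i
    fin_cases i <;> simp [offEdge]
  refine (joinedIn_signedVertex h (σ' := 1) 2 4 ?_).trans ?_
  · intro i
    fin_cases i <;> simp [offEdge]
  exact joinedIn_signedVertex h 4 0 fun _ _ => rfl

/-- The polyhedral surface is compact, as the space of a finite complex. -/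
theorem isCompact_polyhedralSurface (h : IsPentagonal a b) : IsCompact (polyhedralSurface a b) := by
  rw [← space_polyhedralComplex h, Geometry.SimplicialComplex.space]
  exact (finite_faces_polyhedralComplex h).isCompact_biUnion
    fun s _ => s.finite_toSet.isCompact_convexHull ℝ

end Connectedness

/-- Over the region `D₂` the level surface is a closed orientable surface of genus `5`. -/
theorem isSmoothSurfaceOfGenus_suslovSurface {a b : ℝ} (h : IsPentagonal a b) :
    IsSmoothSurfaceOfGenus 5 (suslovSurface 1 1 a b) := by
  have hex := exists_isManifold_levelSet (d := 2) contDiff_suslovMap (a, b, 1)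
    (by simp) fun x hx =>
      surjective_fderiv_suslovMap h.left_lt_one h.right_lt_one h.one_lt_add hx
  rw [setOf_suslovMap_eq] at hex
  obtain ⟨C, hM, hC⟩ := hex
  -- The smooth structure is now fixed; the topological properties are transported from the
  -- polyhedral model to the same space.
  let e := suslovSurfaceHomeomorph a b
  have : CompactSpace (polyhedralSurface a b) :=
    isCompact_iff_compactSpace.1 (isCompact_polyhedralSurface h)
  have : ConnectedSpace (polyhedralSurface a b) :=
    isConnected_iff_connectedSpace.1 (isPathConnected_polyhedralSurface h).isConnected
  refine ⟨suslovSurface 1 1 a b, inferInstance, C, hM, ⟨e.symm.compactSpace, inferInstance,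
    e.symm.surjective.connectedSpace e.symm.continuous, ⟨C⟩, 5, polyhedralComplex h,
    finite_faces_polyhedralComplex h,
    ⟨(Homeomorph.setCongr (space_polyhedralComplex h)).trans e.symm⟩,
    isCoherentlyOrientable_polyhedralComplex h, ?_⟩, hC⟩
  rw [simplicialEulerChar_polyhedralComplex h]
  norm_num

theorem proposition3p4 (b₁ b₂ : ℝ) (hb₁ : 0 < b₁) (hb₂ : 0 < b₂) (k₁ k₂ : ℝ) :
    ((k₁, k₂) ∈ regionD1 b₁ b₂ →
      IsDiffeomorphicCopy ((𝓡 1).prod (𝓡 1)) (Torus2 ⊕ Torus2) (suslovSurface b₁ b₂ k₁ k₂)) ∧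
    ((k₁, k₂) ∈ regionD2 b₁ b₂ →
      IsSmoothSurfaceOfGenus 5 (suslovSurface b₁ b₂ k₁ k₂)) ∧
    ((k₁, k₂) ∈ regionD3 b₁ b₂ ∪ regionD4 b₁ b₂ →
      IsDiffeomorphicCopy ((𝓡 1).prod (𝓡 1)) (Torus2 ⊕ Torus2) (suslovSurface b₁ b₂ k₁ k₂)) ∧
    ((k₁, k₂) ∈ regionD5 b₁ b₂ →
      IsDiffeomorphicCopy (𝓡 2) ((Sphere2 ⊕ Sphere2) ⊕ (Sphere2 ⊕ Sphere2))
        (suslovSurface b₁ b₂ k₁ k₂)) := by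
  obtain ⟨L, hL⟩ := exists_image_suslovSurface_eq hb₁ hb₂ k₁ k₂
  rw [← hL]
  refine ⟨?_, ?_, ?_, ?_⟩
  · rintro ⟨h1, h2, h3⟩
    exact (isDiffeomorphicCopy_of_add_lt_one (div_pos h1 hb₁) (div_pos h2 hb₂) h3).image L
  · rintro ⟨h1, h2, h3, h4, h5⟩
    obtain ⟨M, _, _, hM, hg, hc⟩ := isSmoothSurfaceOfGenus_suslovSurface
      ⟨div_pos h1 hb₁, div_pos h2 hb₂, (div_lt_one hb₁).2 h3, (div_lt_one hb₂).2 h4, h5⟩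
    exact ⟨M, _, _, hM, hg, hc.image L⟩
  · rintro (⟨h1, h2, h3, h4⟩ | ⟨h1, h2, h3, h4⟩)
    · exact (isDiffeomorphicCopy_of_one_lt_of_lt_one ((one_lt_div hb₁).2 h3) (div_pos h2 hb₂)
        ((div_lt_one hb₂).2 h4)).image L
    · exact (isDiffeomorphicCopy_of_lt_one_of_one_lt (div_pos h1 hb₁) ((div_lt_one hb₁).2 h3)
        ((one_lt_div hb₂).2 h4)).image L
  · rintro ⟨h1, h2, h3, h4⟩
    exact (isDiffeomorphicCopy_of_one_lt_of_one_lt ((one_lt_div hb₁).2 h3)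
      ((one_lt_div hb₂).2 h4)).image L
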